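/- **Setting.** Let $\mathcal A$ be a set of particles and $\mathcal L=(L(\alpha,\beta))_{\alpha,\beta\in\mathcal A}$ a real symmetric matrix, with finitely many non-zero entries in each row, such that $\mathcal L>0$ in $l^2(\mathcal A)$. Let $\mathcal C$ be a finite set of channels $\sigma=\{\sigma(k)\}_{k\ge 0}$, all particles $\sigma(k)$ ($\sigma\in\mathcal C$, $k\ge0$) being distinct, such that for $k\ge1$ the particle $\sigma(k)$ interacts, apart from itself, only with $\sigma(k-1)$ and $\sigma(k+1)$, and such that the central part $\mathcal A_1=\mathcal A\setminus\{\sigma(k):\sigma\in\mathcal C,\,k\ge1\}$ is finite. Put $\mathfrak a_\sigma(k)=L(\sigma(k),\sigma(k))$ and $\mathfrak b_\sigma(k)=-L(\sigma(k),\sigma(k+1))$, and assume $\mathfrak b_\sigma(k)>0$ and, for some $a_\sigma\in\mathbb R$, $b_\sigma>0$, $\epsilon>0$, $$\sum_{k\ge1}(1+\epsilon)^k\bigl(|\mathfrak a_\sigma(k)-a_\sigma|+|\mathfrak b_\sigma(k)-b_\sigma|\bigr)<\infty .$$ Assume that $\bigcup_\sigma(a_\sigma-2b_\sigma,a_\sigma+2b_\sigma)$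 is connected and let $a,b$ be defined by $\bigcup_\sigma[a_\sigma-2b_\sigma,a_\sigma+2b_\sigma]=[a-2b,a+2b]$. Put $\lambda(\omega)=a-b(\omega+\omega^{-1})$ and $\lambda_\sigma(\theta)=a_\sigma-b_\sigma(\theta+\theta^{-1})$. Let $\theta_\sigma=\lambda_\sigma^{-1}\circ\lambda:\mathbb D\to\mathbb D$, where $\lambda_\sigma$ is inverted on the open unit disk $\mathbb D$; it extends continuously to $\overline{\mathbb D}$, and $T_\sigma^+$ is the set of $\omega\in\mathbb T$ with $|\theta_\sigma(\omega)|=1$. Let $e_\sigma(k,\theta)$, $k\ge0$, be the Jost solutions: holomorphic for $\theta\in\mathbb D$, continuous on $\overline{\mathbb D}$, satisfying $$-\mathfrak b_\sigma(k-1)x(k-1)+\mathfrak a_\sigma(k)x(k)-\mathfrak b_\sigma(k)x(k+1)=\lambda x(k),\qquad k\ge1,$$ with $\lambda=\lambda_\sigma(\theta)$, and $e_\sigma(k,\theta)=\theta^k(1+o(1))$ as $k\to\infty$ uniformly in $\overline{\mathbb D}$. Let $p_\sigma(k,\omega)$ be the solution of the same equation with $\lambda=\lambda(\omega)$ and $p_\sigma(0,\omega)=1$,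 $p_\sigma(1,\omega)=0$. Let $\mathcal L_1=(L(\alpha,\beta))_{\alpha,\beta\in\mathcal A_1}$ and let $\mathcal R(\lambda)$ be the $\mathcal C\times\mathcal C$ matrix of the entries of $(\mathcal L_1-\lambda)^{-1}$ at the positions $(\sigma(0),\nu(0))$. Put $\mathcal E(k,\omega)=\mathrm{diag}\{e_\sigma(k,\theta_\sigma(\omega))\}$, $P(k,\omega)=\mathrm{diag}\{p_\sigma(k,\omega)\}$, $B=\mathrm{diag}\{b_\sigma\}$, $B(0)=\mathrm{diag}\{\mathfrak b_\sigma(0)\}$, $D(\omega)=\mathrm{diag}\{\theta_\sigma(\omega)^{-1}-\theta_\sigma(\omega)\}$, $T(\omega)=\mathcal E(0,\omega)-\mathcal R(\lambda(\omega))B(0)\mathcal E(1,\omega)$ and $$U(k,\omega)=(u_{\sigma\nu}(k,\omega))_{\sigma,\nu\in\mathcal C}=\bigl[-P(k,\omega)+\mathcal E(k,\omega)T(\omega)^{-1}\bigr]B\,B(0)^{-1}D(\omega)\,\mathcal E(1,\omega)^{-1}.$$ At a point of $\mathbb T$, "pole" and "regular" refer to the meromorphic, respectively analytic, continuation of an entry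 from $\mathbb D$ to a neighbourhood of this point; a pole of $U(k,\cdot)$ is a pole of at least one of its entries. **Lemma.** Let $\hat\omega\in\overline{\mathbb D}\setminus\{0\}$ be such that $\lambda(\hat\omega)\ne a_\gamma\pm2b_\gamma$ for all $\gamma\in\mathcal C$ (this is automatic if $|\hat\omega|<1$), and let $\hat\omega$ be a pole of $U(k,\cdot)$ for some $k\ge0$. Then $\lambda(\hat\omega)=a-b(\hat\omega+\hat\omega^{-1})$ is an eigenvalue of $\mathcal L$ in $l^2(\mathcal A)$: there is a non-zero $\xi\in l^2(\mathcal A)$ with $\mathcal L\xi=\lambda(\hat\omega)\xi$. If in addition $\hat\omega\in T_\sigma^+$, then all entries $u_{\sigma\nu}(j,\cdot)$, $\nu\in\mathcal C$, $j\ge0$, are regular at $\hat\omega$. -/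

import Mathlib

open Filter Topology

/-- A web-like system of particles: `A` is the set of particles, `C` the (finite) set of channels,
`L` the interaction matrix, `chan σ k` the particle `σ(k)` and `chan σ 0` the attachment point of
the channel `σ`.  `aCh σ`, `bCh σ` are the limits of the coefficients along `σ`, and
`[a - 2b, a + 2b]` is the union of the segments `[a_σ - 2b_σ, a_σ + 2b_σ]`. -/
structure WebSystem (A C : Type*) where
  L : A → A → ℝ
  chan : C → ℕ → A
  aCh : C → ℝ
  bCh : C → ℝ
  a : ℝ
  b : ℝ
  symm : ∀ α β, L α β = L β α
  /-- Each particle interacts with finitely many particles. -/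
  finite_row : ∀ α, {β | L α β ≠ 0}.Finite
  /-- `L > 0` in `l²(A)`. -/
  pos : ∀ ξ : lp (fun _ : A => ℝ) 2, ξ ≠ 0 → 0 < ∑' α, ξ α * ∑ᶠ β, L α β * ξ β
  /-- The particles `σ(k)` are pairwise distinct. -/
  chan_inj : ∀ σ ν j k, chan σ j = chan ν k → σ = ν ∧ j = k
  /-- For `k ≥ 1` the particle `σ(k)` interacts at most with `σ(k-1)`, `σ(k)`, `σ(k+1)`. -/
  chan_only : ∀ σ k β, L (chan σ (k + 1)) β ≠ 0 →
    β = chan σ k ∨ β = chan σ (k + 1) ∨ β = chan σ (k + 2)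
  /-- The off-diagonal coefficients `𝔟_σ(k) = -L(σ(k), σ(k+1))` are positive. -/
  chan_neg : ∀ σ k, L (chan σ k) (chan σ (k + 1)) < 0
  /-- The central part is finite. -/
  finite_central : {α | ∀ σ k, α ≠ chan σ (k + 1)}.Finite
  bCh_pos : ∀ σ, 0 < bCh σ
  /-- The coefficients converge exponentially fast along every channel. -/
  decay : ∃ ε : ℝ, 0 < ε ∧ ∀ σ, Summable fun k : ℕ => (1 + ε) ^ (k + 1) *
    (|L (chan σ (k + 1)) (chan σ (k + 1)) - aCh σ| +
      |-L (chan σ (k + 1)) (chan σ (k + 2)) - bCh σ|)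
  connected : IsConnected (⋃ σ, Set.Ioo (aCh σ - 2 * bCh σ) (aCh σ + 2 * bCh σ))
  union_eq : (⋃ σ, Set.Icc (aCh σ - 2 * bCh σ) (aCh σ + 2 * bCh σ)) =
    Set.Icc (a - 2 * b) (a + 2 * b)

namespace WebSystem

variable {A C : Type*} (S : WebSystem A C)

/-- The diagonal coefficient `𝔞_σ(k) = L(σ(k), σ(k))`. -/
def diagCoeff (σ : C) (k : ℕ) : ℝ := S.L (S.chan σ k) (S.chan σ k)

/-- The off-diagonal coefficient `𝔟_σ(k) = -L(σ(k), σ(k+1))`. -/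
def offCoeff (σ : C) (k : ℕ) : ℝ := -S.L (S.chan σ k) (S.chan σ (k + 1))

/-- `ξ ∈ l²(A)`, `ξ ≠ 0`, `L ξ = z ξ` (the sums are finite). -/
def IsEigenvalue (z : ℂ) : Prop :=
  ∃ ξ : lp (fun _ : A => ℂ) 2, ξ ≠ 0 ∧ ∀ α, ∑ᶠ β, (S.L α β : ℂ) * ξ β = z * ξ α

/-- The spectral parameter `λ(ω) = a - b (ω + ω⁻¹)`. -/
noncomputable def lam (ω : ℂ) : ℂ := S.a - S.b * (ω + ω⁻¹)

/-- The spectral parameter of a channel, `λ_σ(θ) = a_σ - b_σ (θ + θ⁻¹)`. -/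
noncomputable def lamCh (σ : C) (θ : ℂ) : ℂ := S.aCh σ - S.bCh σ * (θ + θ⁻¹)

/-- `θ_σ = λ_σ⁻¹ ∘ λ` on the open unit disk, where `λ_σ` is inverted on the open unit disk
(both `λ` and `λ_σ` send `0` to `∞`). -/
noncomputable def theta (σ : C) (ω : ℂ) : ℂ :=
  open Classical in
  if ω = 0 then 0
  else Function.invFunOn (S.lamCh σ) {θ : ℂ | ‖θ‖ < 1 ∧ θ ≠ 0} (S.lam ω)

/-- The set `T_σ⁺` of points of the unit circle at which the continuous boundary value of `θ_σ`
lies on the unit circle. -/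
def TPlus (σ : C) : Set ℂ :=
  {ω | ‖ω‖ = 1 ∧ ‖extendFrom (Metric.ball (0 : ℂ) 1) (S.theta σ) ω‖ = 1}

/-- `e k θ` is the family of Jost solutions on the channel `σ`: holomorphic in the open disk,
continuous on the closed disk, a solution of the channel equation, and
`e k θ = θ ^ k (1 + o(1))` as `k → ∞` uniformly on the closed disk. -/
structure IsJostFamily (σ : C) (e : ℕ → ℂ → ℂ) : Prop where
  holo : ∀ k, DifferentiableOn ℂ (e k) (Metric.ball 0 1)
  cont : ∀ k, ContinuousOn (e k) (Metric.closedBall 0 1)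
  eqn : ∀ k, ∀ θ ∈ Metric.closedBall (0 : ℂ) 1, θ ≠ 0 →
    -(S.offCoeff σ k : ℂ) * e k θ + (S.diagCoeff σ (k + 1) : ℂ) * e (k + 1) θ
      - (S.offCoeff σ (k + 1) : ℂ) * e (k + 2) θ = S.lamCh σ θ * e (k + 1) θ
  asymp : ∀ η : ℝ, 0 < η → ∃ K : ℕ, ∀ k ≥ K, ∀ θ ∈ Metric.closedBall (0 : ℂ) 1,
    ‖e k θ - θ ^ k‖ ≤ η * ‖θ‖ ^ k

/-- The Jost solutions `e_σ(k, θ)` (the properties above determine them on the closed disk). -/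
noncomputable def jost (σ : C) : ℕ → ℂ → ℂ := Classical.epsilon (S.IsJostFamily σ)

/-- The solution `p_σ(k, ·)`, as a function of `z = λ(ω)`, of the channel equation with
`p_σ(0) = 1`, `p_σ(1) = 0`. -/
noncomputable def pSol (σ : C) (z : ℂ) : ℕ → ℂ
  | 0 => 1
  | 1 => 0
  | k + 2 => (((S.diagCoeff σ (k + 1) : ℂ) - z) * pSol σ z (k + 1)
      - (S.offCoeff σ k : ℂ) * pSol σ z k) / (S.offCoeff σ (k + 1) : ℂ)

/-- The central part: all particles other than `σ(k)`, `k ≥ 1`. -/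
def central : Set A := {α | ∀ σ k, α ≠ S.chan σ (k + 1)}

noncomputable instance fintypeCentral : Fintype S.central := S.finite_central.fintype

theorem chan_zero_mem_central (σ : C) : S.chan σ 0 ∈ S.central := by
  intro ν k h
  have := (S.chan_inj _ _ _ _ h).2
  omega

/-- The attachment point `σ(0)`, as an element of the central part. -/
def attach (σ : C) : S.central := ⟨S.chan σ 0, S.chan_zero_mem_central σ⟩

/-- The truncation of `L` to the central part. -/
def L₁ : Matrix S.central S.central ℂ := Matrix.of fun α β => (S.L α β : ℂ)

open Classical in
/-- The matrix `(r(σ(0), ν(0); z))_{σ,ν}`, where `r(·, ·; z)` are the entries of `(L₁ - z)⁻¹`. -/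
noncomputable def R (z : ℂ) : Matrix C C ℂ :=
  Matrix.of fun σ ν => (S.L₁ - Matrix.scalar S.central z)⁻¹ (S.attach σ) (S.attach ν)

variable [DecidableEq C]

/-- `B = diag(b_σ)`. -/
noncomputable def B : Matrix C C ℂ := Matrix.diagonal fun σ => (S.bCh σ : ℂ)

/-- `B(0) = diag(𝔟_σ(0))`. -/
noncomputable def B₀ : Matrix C C ℂ := Matrix.diagonal fun σ => (S.offCoeff σ 0 : ℂ)

/-- `E(k, ω) = diag(e_σ(k, θ_σ(ω)))`. -/
noncomputable def E (k : ℕ) (ω : ℂ) : Matrix C C ℂ :=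
  Matrix.diagonal fun σ => S.jost σ k (S.theta σ ω)

/-- `P(k, ω) = diag(p_σ(k, ω))`. -/
noncomputable def P (k : ℕ) (ω : ℂ) : Matrix C C ℂ :=
  Matrix.diagonal fun σ => S.pSol σ (S.lam ω) k

/-- `D(ω) = diag(θ_σ(ω)⁻¹ - θ_σ(ω))`. -/
noncomputable def D (ω : ℂ) : Matrix C C ℂ :=
  Matrix.diagonal fun σ => (S.theta σ ω)⁻¹ - S.theta σ ω

variable [Fintype C]

/-- `T(ω) = E(0, ω) - R(λ(ω)) B(0) E(1, ω)`. -/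
noncomputable def T (ω : ℂ) : Matrix C C ℂ :=
  S.E 0 ω - S.R (S.lam ω) * S.B₀ * S.E 1 ω

/-- `U(k, ω) = [-P(k, ω) + E(k, ω) T(ω)⁻¹] B B(0)⁻¹ D(ω) E(1, ω)⁻¹`, for `ω` in the open disk. -/
noncomputable def U (k : ℕ) (ω : ℂ) : Matrix C C ℂ :=
  (-S.P k ω + S.E k ω * (S.T ω)⁻¹) * S.B * (S.B₀)⁻¹ * S.D ω * (S.E 1 ω)⁻¹

end WebSystem

/-- `f`, a function on the open unit disk, has a pole at the point `w` of the closed disk: near `w`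
it is the restriction of a function that is meromorphic at `w` with a pole there.
The continuation is unique up to its value at `w`. -/
def HasPoleAt (f : ℂ → ℂ) (w : ℂ) : Prop :=
  ∃ g : ℂ → ℂ, MeromorphicAt g w ∧ meromorphicOrderAt g w < 0 ∧
    g =ᶠ[𝓝[Metric.ball 0 1 \ {w}] w] f

/-- `f`, a function on the open unit disk, is regular at the point `w` of the closed disk: near `w`
it is the restriction of a function that is analytic at `w`. -/
def IsRegularAt (f : ℂ → ℂ) (w : ℂ) : Prop :=
  ∃ g : ℂ → ℂ, AnalyticAt ℂ g w ∧ g =ᶠ[𝓝[Metric.ball 0 1 \ {w}] w] f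

/-! Column `ν` of `U` consists of the channel values of a solution `ψ` of `L ψ = λ(ω) ψ`. The
Wronskian of `ψ` with the Jost solution of the channel `σ` vanishes for `σ ≠ ν`, and on `ν` it is
`-b_ν (θ_ν⁻¹ - θ_ν)`. All of this continues past `w`: exponential decay makes the Jost solutions
holomorphic in a disk of radius `> 1` (`exists_jost_extension`), and away from thresholds `θ_σ` is
locally an analytic root of a quadratic equation (`exists_theta_extension`). So each column is
meromorphic at `w`, with Wronskians analytic there (`IsLocalJost.isColumn`).

If a column has a pole, its leading Laurent coefficients form a non-zero solution for `λ(w)`. The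
Wronskians, being analytic, disappear in this limit, so on each channel the limit is a multiple of
the Jost solution (`IsColumn.exists_limit`). Where `|θ_σ(w)| < 1` this is square summable. Where
`|θ_σ(w)| = 1` it is square summable only if the multiple is `0`, and one must show that the pole
does not reach this channel.

This is `IsColumn.analyticOffAt_of_not_summable`. Write `ψ = s_σ e_σ + q_σ` at `σ(0)`, `σ(1)`, with
`q_σ` analytic and zero for `σ ≠ ν`, and put `G_σ = ∑_{k ≥ 1} |e_σ(k)|²`. For non-real `λ`,
conservation of flux and symmetry of `L` on the central part give `|Im λ| |s_σ|² G_σ ≤ K (|s_ν| +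
1)`. With `σ = ν` this bounds `|Im λ| |s_ν|`; hence `|Im λ|² |s_σ|² G_σ` is bounded for every `σ`.
As `ω → w` radially, `|Im λ| ≥ c |ω - w|`, while `G_σ → ∞` if the Jost solution at `w` is not square
summable. Hence `(ω - w) s_σ → 0`, and the meromorphic function `s_σ` has no pole. -/

/-! ### Backward three-term recurrences with holomorphic coefficients -/

section BackwardRecurrence

/-- The solution of `h k = p k * h (k + 1) - q k * h (k + 2)` with `h = 1` from index `k + n` on. -/
def backApprox (p q : ℕ → ℂ → ℂ) : ℕ → ℕ → ℂ → ℂ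
  | 0, _, _ => 1
  | 1, k, θ => p k θ - q k θ
  | n + 2, k, θ => p k θ * backApprox p q (n + 1) (k + 1) θ - q k θ * backApprox p q n (k + 2) θ

/-- The increments of `backApprox`, preceded by `0`. -/
def backDiff (p q : ℕ → ℂ → ℂ) : ℕ → ℕ → ℂ → ℂ
  | 0, _, _ => 0
  | n + 1, k, θ => backApprox p q (n + 1) k θ - backApprox p q n k θ

theorem backDiff_succ_succ (p q : ℕ → ℂ → ℂ) (n k : ℕ) (θ : ℂ) :
    backDiff p q (n + 2) k θ =
      p k θ * backDiff p q (n + 1) (k + 1) θ - q k θ * backDiff p q n (k + 2) θ := by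
  rcases n with _ | n <;> simp only [backDiff, backApprox] <;> ring

theorem backApprox_differentiableOn {p q : ℕ → ℂ → ℂ} {s : Set ℂ}
    (hp : ∀ k, DifferentiableOn ℂ (p k) s) (hq : ∀ k, DifferentiableOn ℂ (q k) s) (n : ℕ) :
    ∀ k, DifferentiableOn ℂ (backApprox p q n k) s ∧
      DifferentiableOn ℂ (backApprox p q (n + 1) k) s := by
  induction n with
  | zero => exact fun k => ⟨differentiableOn_const _, (hp k).sub (hq k)⟩
  | succ n ih =>
    exact fun k => ⟨(ih k).2, ((hp k).mul (ih (k + 1)).2).sub ((hq k).mul (ih (k + 2)).1)⟩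

/-- The limiting step `x' = (1 + θ²) x - θ² y` satisfies `x' - x = θ² (x - y)`: it fixes constants
and multiplies differences by `θ²`. The norm `‖x‖ + M ‖x - y‖` is adapted to this splitting, so for
small `δ` one step grows it by a factor governed only by `r` and `M`. -/
theorem norm_backStep_le {P Q x y θ : ℂ} {δ r M c : ℝ} (hM : 0 < M) (hθ : ‖θ‖ < r)
    (hP : ‖P - (1 + θ ^ 2)‖ ≤ δ) (hQ : ‖Q - θ ^ 2‖ ≤ δ)
    (h1 : 1 + 2 * (1 + M) * δ ≤ c) (h2 : (1 + M) * (r ^ 2 + δ) ≤ c * M) :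
    ‖P * x - Q * y‖ + M * ‖P * x - Q * y - x‖ ≤ c * (‖x‖ + M * ‖x - y‖) := by
  have e1 : P * x - Q * y - x = Q * (x - y) + ((P - (1 + θ ^ 2)) - (Q - θ ^ 2)) * x := by ring
  have hQ' : ‖Q‖ ≤ r ^ 2 + δ := by
    calc ‖Q‖ = ‖θ ^ 2 + (Q - θ ^ 2)‖ := by congr 1; ring
      _ ≤ ‖θ ^ 2‖ + ‖Q - θ ^ 2‖ := norm_add_le _ _
      _ ≤ r ^ 2 + δ := by rw [norm_pow]; gcongr
  have g : ‖P * x - Q * y - x‖ ≤ (r ^ 2 + δ) * ‖x - y‖ + (2 * δ) * ‖x‖ := by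
    rw [e1]
    refine (norm_add_le _ _).trans ?_
    rw [norm_mul, norm_mul]
    gcongr
    exact (norm_sub_le _ _).trans (by linarith)
  have g2 : ‖P * x - Q * y‖ ≤ ‖x‖ + ‖P * x - Q * y - x‖ := by
    calc ‖P * x - Q * y‖ = ‖x + (P * x - Q * y - x)‖ := by congr 1; ring
      _ ≤ _ := norm_add_le _ _
  have h3 := mul_le_mul_of_nonneg_right h1 (norm_nonneg x)
  have h4 := mul_le_mul_of_nonneg_right h2 (norm_nonneg (x - y))
  nlinarith [mul_le_mul_of_nonneg_left g (by linarith : (0 : ℝ) ≤ 1 + M)]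

/-- The solution is the limit of `backApprox` as the starting index goes to infinity. An increment
is born at index `k + n` with size `O(δ (k + n))` and is carried back to `k` with growth at most `ρ`
per step, up to a constant. Summability of `ρ ^ k * δ k` then gives uniform convergence on the disk
of radius `r > 1`. -/
theorem exists_back_solution {p q : ℕ → ℂ → ℂ} {δ : ℕ → ℝ} {ρ r : ℝ} (hr : 1 < r)
    (hρ : r ^ 3 < ρ) (hδ : Summable fun k => ρ ^ k * δ k)
    (hp : ∀ k θ, ‖θ‖ < r → ‖p k θ - (1 + θ ^ 2)‖ ≤ δ k)
    (hq : ∀ k θ, ‖θ‖ < r → ‖q k θ - θ ^ 2‖ ≤ δ k)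
    (hpd : ∀ k, DifferentiableOn ℂ (p k) (Metric.ball 0 r))
    (hqd : ∀ k, DifferentiableOn ℂ (q k) (Metric.ball 0 r)) :
    ∃ h : ℕ → ℂ → ℂ, (∀ k, DifferentiableOn ℂ (h k) (Metric.ball 0 r)) ∧
      (∀ k θ, ‖θ‖ < r → h k θ = p k θ * h (k + 1) θ - q k θ * h (k + 2) θ) ∧
      ∀ η : ℝ, 0 < η → ∃ K, ∀ k ≥ K, ∀ θ, ‖θ‖ < r → ‖h k θ - 1‖ ≤ η := by
  have hρ1 : 1 < ρ := lt_trans (one_lt_pow₀ hr (by norm_num)) hρ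
  have hδ0 : ∀ k, 0 ≤ δ k := fun k => (norm_nonneg _).trans (hp k 0 (by simp; linarith))
  -- This weight gives `1 + M = r M`, so for `δ = 0` the second condition of `norm_backStep_le` with
  -- `c = ρ` reads `r³ ≤ ρ`.
  obtain ⟨M, hMdef⟩ : ∃ M, M = 1 / (r - 1) := ⟨_, rfl⟩
  have hr1 : 0 < r - 1 := by linarith
  have hM : 0 < M := by rw [hMdef]; positivity
  have hMr : 1 + M = r * M := by rw [hMdef]; field_simp; ring
  have hδt : Tendsto δ atTop (𝓝 0) := by
    refine squeeze_zero hδ0 (fun k => ?_) hδ.tendsto_atTop_zero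
    exact le_mul_of_one_le_left (hδ0 k) (one_le_pow₀ hρ1.le)
  obtain ⟨E, hE⟩ : ∃ E : ℕ → ℕ → ℂ → ℝ, E = fun n k θ => ‖backDiff p q (n + 1) k θ‖ +
    M * ‖backDiff p q (n + 1) k θ - backDiff p q n (k + 1) θ‖ := ⟨_, rfl⟩
  have hEv : ∀ n k θ, ‖backDiff p q (n + 1) k θ‖ ≤ E n k θ := by
    intro n k θ; rw [hE]; simp only [le_add_iff_nonneg_right]; positivity
  have step : ∀ c k, 1 + 2 * (1 + M) * δ k ≤ c → (1 + M) * (r ^ 2 + δ k) ≤ c * M →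
      ∀ n θ, ‖θ‖ < r → E (n + 1) k θ ≤ c * E n (k + 1) θ := by
    intro c k h1 h2 n θ hθ
    have := norm_backStep_le (x := backDiff p q (n + 1) (k + 1) θ)
      (y := backDiff p q n (k + 2) θ) hM hθ (hp k θ hθ) (hq k θ hθ) h1 h2
    simp only [hE, backDiff_succ_succ p q n k θ]
    exact this
  have base : ∀ k θ, ‖θ‖ < r → E 0 k θ ≤ 2 * (1 + M) * δ k := by
    intro k θ hθ
    have : ‖p k θ - q k θ - 1‖ ≤ 2 * δ k := by
      calc ‖p k θ - q k θ - 1‖ = ‖(p k θ - (1 + θ ^ 2)) - (q k θ - θ ^ 2)‖ := by congr 1; ring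
        _ ≤ _ := (norm_sub_le _ _).trans (by linarith [hp k θ hθ, hq k θ hθ])
    simp only [hE, backDiff, backApprox, sub_zero]
    nlinarith
  obtain ⟨K, hK⟩ : ∃ K, ∀ k ≥ K, 1 + 2 * (1 + M) * δ k ≤ ρ ∧
      (1 + M) * (r ^ 2 + δ k) ≤ ρ * M := by
    have t1 : Tendsto (fun k => 1 + 2 * (1 + M) * δ k) atTop (𝓝 (1 + 2 * (1 + M) * 0)) :=
      (hδt.const_mul _).const_add _
    have t2 : Tendsto (fun k => (1 + M) * (r ^ 2 + δ k)) atTop (𝓝 ((1 + M) * (r ^ 2 + 0))) :=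
      (hδt.const_add _).const_mul _
    have h1 : 1 + 2 * (1 + M) * 0 < ρ := by linarith
    have h2 : (1 + M) * (r ^ 2 + 0) < ρ * M := by rw [hMr]; nlinarith
    exact eventually_atTop.1 ((t1.eventually_le_const h1).and (t2.eventually_le_const h2))
  have boundK : ∀ n, ∀ k ≥ K, ∀ θ, ‖θ‖ < r →
      E n k θ ≤ 2 * (1 + M) * (ρ ^ n * δ (k + n)) := by
    intro n
    induction n with
    | zero => intro k _ θ hθ; simpa using base k θ hθ
    | succ n ih =>
      intro k hk θ hθ
      refine (step ρ k (hK k hk).1 (hK k hk).2 n θ hθ).trans ?_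
      refine (mul_le_mul_of_nonneg_left (ih (k + 1) (by omega) θ hθ) (by linarith)).trans ?_
      rw [show k + 1 + n = k + (n + 1) by ring, pow_succ]
      exact le_of_eq (by ring)
  -- The finitely many indices below `K`, where the growth factor may exceed `ρ`, only change the
  -- constant.
  have bound : ∀ j k, K ≤ k + j → ∃ Cc : ℝ, 0 ≤ Cc ∧ ∀ n θ, ‖θ‖ < r →
      E n k θ ≤ Cc * (ρ ^ n * δ (k + n)) := by
    intro j
    induction j with
    | zero => exact fun k hk => ⟨2 * (1 + M), by positivity, fun n => boundK n k hk⟩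
    | succ j ih =>
      intro k hk
      obtain ⟨C1, hC1, h1⟩ := ih (k + 1) (by omega)
      obtain ⟨c, hc1, hc2, hc0⟩ : ∃ c, 1 + 2 * (1 + M) * δ k ≤ c ∧
          (1 + M) * (r ^ 2 + δ k) ≤ c * M ∧ 0 ≤ c := by
        refine ⟨max (1 + 2 * (1 + M) * δ k) ((1 + M) * (r ^ 2 + δ k) / M), le_max_left _ _, ?_, ?_⟩
        · exact (div_le_iff₀ hM).1 (le_max_right _ _)
        · exact le_max_of_le_right (by have := hδ0 k; positivity)
      refine ⟨max (2 * (1 + M)) (c * C1), le_max_of_le_left (by positivity), fun n θ hθ => ?_⟩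
      have hw : ∀ m, 0 ≤ ρ ^ m * δ (k + m) := fun m => by have := hδ0 (k + m); positivity
      rcases n with _ | n
      · refine (base k θ hθ).trans ?_
        have := mul_le_mul_of_nonneg_right (le_max_left (2 * (1 + M)) (c * C1)) (hw 0)
        simpa using this
      · refine (step c k hc1 hc2 n θ hθ).trans ?_
        refine (mul_le_mul_of_nonneg_left (h1 n θ hθ) hc0).trans ?_
        refine le_trans ?_ (mul_le_mul_of_nonneg_right (le_max_right (2 * (1 + M)) (c * C1))
          (hw (n + 1)))
        rw [show k + 1 + n = k + (n + 1) by ring, pow_succ, ← mul_assoc]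
        have := hδ0 (k + (n + 1))
        have h3 : ρ ^ n ≤ ρ ^ n * ρ := le_mul_of_one_le_right (by positivity) hρ1.le
        gcongr
  have hsum : ∀ k, Summable fun n => ρ ^ n * δ (k + n) := by
    intro k
    refine Summable.of_nonneg_of_le (fun n => by have := hδ0 (k + n); positivity) (fun n => ?_)
      ((summable_nat_add_iff k).2 hδ)
    rw [add_comm k n]
    exact mul_le_mul_of_nonneg_right (pow_le_pow_right₀ hρ1.le (by omega)) (hδ0 _)
  have hvs : ∀ k θ, ‖θ‖ < r → Summable fun n => backDiff p q (n + 1) k θ := by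
    intro k θ hθ
    obtain ⟨Cc, -, hb⟩ := bound K k (by omega)
    exact Summable.of_norm_bounded ((hsum k).mul_left Cc) fun n => (hEv n k θ).trans (hb n θ hθ)
  have htend : ∀ k θ, ‖θ‖ < r → Tendsto (fun n => backApprox p q n k θ) atTop
      (𝓝 (1 + ∑' n, backDiff p q (n + 1) k θ)) := by
    intro k θ hθ
    have h1 := ((hvs k θ hθ).hasSum.tendsto_sum_nat).const_add 1
    refine h1.congr fun n => ?_
    simp only [backDiff]
    rw [Finset.sum_range_sub (fun n => backApprox p q n k θ)]
    simp [backApprox]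
  refine ⟨fun k θ => 1 + ∑' n, backDiff p q (n + 1) k θ, fun k => ?_, fun k θ hθ => ?_, ?_⟩
  · obtain ⟨Cc, -, hb⟩ := bound K k (by omega)
    refine (differentiableOn_const _).add ?_
    refine Complex.differentiableOn_tsum_of_summable_norm ((hsum k).mul_left Cc) (fun n => ?_)
      Metric.isOpen_ball fun n θ hθ => (hEv n k θ).trans (hb n θ (by simpa using hθ))
    exact (backApprox_differentiableOn hpd hqd (n + 1) k).1.sub
      (backApprox_differentiableOn hpd hqd n k).1
  · have h0 := (tendsto_add_atTop_iff_nat 2).2 (htend k θ hθ)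
    have h1 := (tendsto_add_atTop_iff_nat 1).2 (htend (k + 1) θ hθ)
    exact tendsto_nhds_unique h0 ((h1.const_mul _).sub ((htend (k + 2) θ hθ).const_mul _))
  · intro η hη
    have ht := (tendsto_sum_nat_add fun k => ρ ^ k * δ k).const_mul (2 * (1 + M))
    rw [mul_zero] at ht
    obtain ⟨K', hK'⟩ := eventually_atTop.1 (ht.eventually_le_const hη)
    refine ⟨max K K', fun k hk θ hθ => ?_⟩
    simp only [add_sub_cancel_left]
    have hs := (summable_nat_add_iff k).2 hδ
    refine (tsum_of_norm_bounded (hs.mul_left (2 * (1 + M))).hasSum fun n => ?_).trans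
      ((tsum_mul_left).trans_le (hK' k (le_of_max_le_right hk)))
    refine (hEv n k θ).trans ((boundK n k (le_of_max_le_left hk) θ hθ).trans ?_)
    rw [add_comm k n]
    have := hδ0 (n + k)
    have h3 : ρ ^ n ≤ ρ ^ (n + k) := pow_le_pow_right₀ hρ1.le (by omega)
    gcongr

end BackwardRecurrence

/-! ### The channel equation: Wronskians, flux and Jost solutions -/

namespace WebSystem

variable {A C : Type*} (S : WebSystem A C)

theorem offCoeff_pos (σ : C) (k : ℕ) : 0 < S.offCoeff σ k := by
  have := S.chan_neg σ k
  simp only [offCoeff]; linarith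

theorem offCoeff_ne_zero (σ : C) (k : ℕ) : (S.offCoeff σ k : ℂ) ≠ 0 :=
  Complex.ofReal_ne_zero.2 (S.offCoeff_pos σ k).ne'

/-- `y` solves the equation of the channel `σ` with spectral parameter `z`. -/
def IsChannelSol (σ : C) (z : ℂ) (y : ℕ → ℂ) : Prop :=
  ∀ k, -(S.offCoeff σ k : ℂ) * y k + (S.diagCoeff σ (k + 1) : ℂ) * y (k + 1)
    - (S.offCoeff σ (k + 1) : ℂ) * y (k + 2) = z * y (k + 1)

theorem IsChannelSol.next {S : WebSystem A C} {σ : C} {z : ℂ} {y : ℕ → ℂ}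
    (h : S.IsChannelSol σ z y) (k : ℕ) :
    y (k + 2) = (((S.diagCoeff σ (k + 1) : ℂ) - z) * y (k + 1)
      - (S.offCoeff σ k : ℂ) * y k) / (S.offCoeff σ (k + 1) : ℂ) := by
  rw [eq_div_iff (S.offCoeff_ne_zero σ _)]
  linear_combination - h k

theorem isChannelSol_pSol (σ : C) (z : ℂ) : S.IsChannelSol σ z (S.pSol σ z) := by
  intro k
  rw [pSol]
  have := S.offCoeff_ne_zero σ (k + 1)
  field_simp
  ring

theorem IsChannelSol.smul_add {S : WebSystem A C} {σ : C} {z : ℂ} {y x : ℕ → ℂ}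
    (h : S.IsChannelSol σ z y) (h' : S.IsChannelSol σ z x) (c d : ℂ) :
    S.IsChannelSol σ z (fun k => c * y k + d * x k) := by
  intro k
  linear_combination c * h k + d * h' k

theorem IsChannelSol.eq_zero_of_forward {S : WebSystem A C} {σ : C} {z : ℂ} {y : ℕ → ℂ}
    (h : S.IsChannelSol σ z y) (h0 : y 0 = 0) (h1 : y 1 = 0) (k : ℕ) : y k = 0 := by
  have : ∀ k, y k = 0 ∧ y (k + 1) = 0 := by
    intro k
    induction k with
    | zero => exact ⟨h0, h1⟩
    | succ k ih => exact ⟨ih.2, by rw [h.next k, ih.1, ih.2]; simp⟩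
  exact (this k).1

theorem IsChannelSol.eq_zero_of_backward {S : WebSystem A C} {σ : C} {z : ℂ} {y : ℕ → ℂ}
    (h : S.IsChannelSol σ z y) (K : ℕ) (hK : ∀ k ≥ K, y k = 0) (k : ℕ) : y k = 0 := by
  induction K with
  | zero => exact hK k k.zero_le
  | succ K ih =>
    refine ih fun j hj => ?_
    rcases hj.eq_or_lt with rfl | hj
    · have := h K
      rw [hK (K + 1) le_rfl, hK (K + 2) (by omega)] at this
      simpa [S.offCoeff_ne_zero σ K] using this
    · exact hK j hj

theorem IsChannelSol.wronskian {S : WebSystem A C} {σ : C} {z : ℂ} {y x : ℕ → ℂ}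
    (h : S.IsChannelSol σ z y) (h' : S.IsChannelSol σ z x) (k : ℕ) :
    (S.offCoeff σ k : ℂ) * (y k * x (k + 1) - y (k + 1) * x k) =
      (S.offCoeff σ 0 : ℂ) * (y 0 * x 1 - y 1 * x 0) := by
  induction k with
  | zero => rfl
  | succ k ih =>
    rw [← ih]
    linear_combination x (k + 1) * h k - y (k + 1) * h' k

/-- The flux of `y` through the link from `σ(k)` to `σ(k + 1)`. -/
noncomputable def flux (σ : C) (y : ℕ → ℂ) (k : ℕ) : ℝ :=
  S.offCoeff σ k * ((starRingEnd ℂ) (y k) * y (k + 1)).im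

/-- Discrete Green identity: multiply the equation at `k + 1` by the conjugate of `y (k + 1)` and
take imaginary parts; the coefficients are real. -/
theorem IsChannelSol.flux_sub {S : WebSystem A C} {σ : C} {z : ℂ} {y : ℕ → ℂ}
    (h : S.IsChannelSol σ z y) (N : ℕ) :
    S.flux σ y 0 - S.flux σ y N = z.im * ∑ k ∈ Finset.range N, ‖y (k + 1)‖ ^ 2 := by
  induction N with
  | zero => simp
  | succ N ih =>
    rw [Finset.sum_range_succ, mul_add, ← ih]
    have e := congrArg Complex.im (congrArg (fun t => (starRingEnd ℂ) (y (N + 1)) * t) (h N))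
    rw [← Complex.normSq_eq_norm_sq, Complex.normSq_apply]
    simp only [flux, Complex.mul_im, Complex.sub_im, Complex.add_im, Complex.neg_im, Complex.sub_re,
      Complex.add_re, Complex.neg_re, Complex.mul_re, Complex.conj_re, Complex.conj_im,
      Complex.ofReal_re, Complex.ofReal_im] at e ⊢
    linarith

theorem summable_offCoeff_sub (σ : C) : ∃ ε : ℝ, 0 < ε ∧
    Summable (fun k : ℕ => (1 + ε) ^ (k + 1) * |S.diagCoeff σ (k + 1) - S.aCh σ|) ∧
    Summable (fun k : ℕ => (1 + ε) ^ k * |S.offCoeff σ k - S.bCh σ|) := by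
  obtain ⟨ε, hε, h⟩ := S.decay
  refine ⟨ε, hε, ?_, (summable_nat_add_iff 1).1 ?_⟩
  · refine Summable.of_nonneg_of_le (fun k => by positivity) (fun k => ?_) (h σ)
    exact mul_le_mul_of_nonneg_left (le_add_of_nonneg_right (abs_nonneg _)) (by positivity)
  · refine Summable.of_nonneg_of_le (fun k => by positivity) (fun k => ?_) (h σ)
    exact mul_le_mul_of_nonneg_left (le_add_of_nonneg_left (abs_nonneg _)) (by positivity)

theorem tendsto_offCoeff (σ : C) : Tendsto (S.offCoeff σ) atTop (𝓝 (S.bCh σ)) := by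
  obtain ⟨ε, hε, -, h⟩ := S.summable_offCoeff_sub σ
  rw [tendsto_iff_dist_tendsto_zero]
  refine squeeze_zero (fun _ => dist_nonneg) (fun k => ?_) h.tendsto_atTop_zero
  rw [Real.dist_eq]
  exact le_mul_of_one_le_left (abs_nonneg _) (one_le_pow₀ (by linarith))

/-- The flux vanishes at infinity, so all flux entering the channel is absorbed in it; `G` is the
limit of the partial sums. -/
theorem IsChannelSol.flux_zero_eq {S : WebSystem A C} {σ : C} {z : ℂ} {y : ℕ → ℂ}
    (h : S.IsChannelSol σ z y) (hy : Tendsto y atTop (𝓝 0)) (hz : z.im ≠ 0) :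
    ∃ G : ℝ, S.flux σ y 0 = z.im * G ∧ ∀ N, ∑ k ∈ Finset.range N, ‖y (k + 1)‖ ^ 2 ≤ G := by
  have hJ : Tendsto (S.flux σ y) atTop (𝓝 0) := by
    have h1 : Tendsto (fun k => (starRingEnd ℂ) (y k) * y (k + 1)) atTop (𝓝 0) := by
      have := ((Complex.continuous_conj.tendsto 0).comp hy).mul ((tendsto_add_atTop_iff_nat 1).2 hy)
      simpa using this
    have h2 := (S.tendsto_offCoeff σ).mul ((Complex.continuous_im.tendsto 0).comp h1)
    rw [Complex.zero_im, mul_zero] at h2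
    exact h2
  have hT : Tendsto (fun N => ∑ k ∈ Finset.range N, ‖y (k + 1)‖ ^ 2) atTop
      (𝓝 (S.flux σ y 0 / z.im)) := by
    have h3 : Tendsto (fun N => (S.flux σ y 0 - S.flux σ y N) / z.im) atTop
        (𝓝 ((S.flux σ y 0 - 0) / z.im)) := (hJ.const_sub _).div_const _
    rw [sub_zero] at h3
    refine h3.congr fun N => ?_
    rw [h.flux_sub N, mul_div_cancel_left₀ _ hz]
  refine ⟨S.flux σ y 0 / z.im, (mul_div_cancel₀ _ hz).symm, fun N => ?_⟩
  refine Monotone.ge_of_tendsto (fun m n hmn => ?_) hT N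
  exact Finset.sum_le_sum_of_subset_of_nonneg (Finset.range_mono hmn) fun _ _ _ => by positivity

/-- Substituting `J k θ = θ ^ k * h k θ` turns the channel equation into a backward recurrence for
`h` whose coefficients approach `1 + θ²` and `θ²` exponentially fast. The gain over the usual Jost
solution is the radius `r > 1`, which allows continuation across the unit circle. -/
theorem exists_jost_extension (σ : C) : ∃ r : ℝ, 1 < r ∧ ∃ J : ℕ → ℂ → ℂ,
    (∀ k, DifferentiableOn ℂ (J k) (Metric.ball 0 r)) ∧
    (∀ θ, ‖θ‖ < r → θ ≠ 0 → S.IsChannelSol σ (S.lamCh σ θ) fun k => J k θ) ∧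
    ∀ η : ℝ, 0 < η → ∃ K : ℕ, ∀ k ≥ K, ∀ θ, ‖θ‖ < r → ‖J k θ - θ ^ k‖ ≤ η * ‖θ‖ ^ k := by
  obtain ⟨ε, hε, hα, hβ⟩ := S.summable_offCoeff_sub σ
  -- For `r = 1 + x` this ensures `r³ < 1 + ε`, since `3x + 3x² + x³ < 8x ≤ ε`.
  obtain ⟨x, hx, hxε⟩ : ∃ x : ℝ, x = min ε 1 / 8 ∧ 0 < x := ⟨_, rfl, by positivity⟩
  have hx1 : x ≤ ε / 8 := by rw [hx]; gcongr; exact min_le_left _ _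
  have hx2 : x ≤ 1 / 8 := by rw [hx]; gcongr; exact min_le_right _ _
  have hr3 : (1 + x) ^ 3 < 1 + ε := by nlinarith [mul_nonneg hxε.le (sub_nonneg.2 hx2), sq_nonneg x]
  have hβinv : ∃ D : ℝ, 0 < D ∧ ∀ k, (S.offCoeff σ k)⁻¹ ≤ D := by
    obtain ⟨D, hD⟩ := ((S.tendsto_offCoeff σ).inv₀ (S.bCh_pos σ).ne').bddAbove_range
    refine ⟨D, lt_of_lt_of_le (inv_pos.2 (S.offCoeff_pos σ 0)) (hD ⟨0, rfl⟩), fun k => hD ⟨k, rfl⟩⟩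
  obtain ⟨D, hD0, hD⟩ := hβinv
  have key := @exists_back_solution
    (p := fun k θ => (θ * ((S.diagCoeff σ (k + 1) : ℂ) - S.aCh σ) + S.bCh σ * (1 + θ ^ 2)) /
      S.offCoeff σ k)
    (q := fun k θ => S.offCoeff σ (k + 1) * θ ^ 2 / S.offCoeff σ k)
    (δ := fun k => 5 * D * (|S.diagCoeff σ (k + 1) - S.aCh σ| + |S.offCoeff σ k - S.bCh σ| +
      |S.offCoeff σ (k + 1) - S.bCh σ|)) (r := 1 + x) (ρ := 1 + ε)
    (by linarith) hr3
  specialize key ?_ ?_ ?_ ?_ ?_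
  · have s1 : Summable fun k : ℕ => (1 + ε) ^ k * |S.diagCoeff σ (k + 1) - S.aCh σ| := by
      refine Summable.of_nonneg_of_le (fun k => by positivity) (fun k => ?_) hα
      exact mul_le_mul_of_nonneg_right (pow_le_pow_right₀ (by linarith) (by omega)) (abs_nonneg _)
    have s2 : Summable fun k : ℕ => (1 + ε) ^ k * |S.offCoeff σ (k + 1) - S.bCh σ| := by
      refine Summable.of_nonneg_of_le (fun k => by positivity) (fun k => ?_)
        ((summable_nat_add_iff 1).2 hβ)
      exact mul_le_mul_of_nonneg_right (pow_le_pow_right₀ (by linarith) (by omega)) (abs_nonneg _)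
    refine (((s1.add hβ).add s2).mul_left (5 * D)).congr fun k => ?_
    ring
  · intro k θ hθ
    have hb := S.offCoeff_ne_zero σ k
    have e : (θ * ((S.diagCoeff σ (k + 1) : ℂ) - S.aCh σ) + S.bCh σ * (1 + θ ^ 2)) /
        S.offCoeff σ k - (1 + θ ^ 2) = (θ * ((S.diagCoeff σ (k + 1) - S.aCh σ : ℝ) : ℂ) -
          ((S.offCoeff σ k - S.bCh σ : ℝ) : ℂ) * (1 + θ ^ 2)) * (((S.offCoeff σ k)⁻¹ : ℝ) : ℂ) := by
      push_cast
      field_simp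
      ring
    have hθ2 : ‖1 + θ ^ 2‖ ≤ 5 := by
      refine (norm_add_le _ _).trans ?_
      rw [norm_one, norm_pow]
      nlinarith [norm_nonneg θ]
    rw [e, norm_mul, Complex.norm_real, Real.norm_of_nonneg (inv_pos.2 (S.offCoeff_pos σ k)).le]
    have h1 : ‖θ * ((S.diagCoeff σ (k + 1) - S.aCh σ : ℝ) : ℂ) -
          ((S.offCoeff σ k - S.bCh σ : ℝ) : ℂ) * (1 + θ ^ 2)‖ ≤
        5 * (|S.diagCoeff σ (k + 1) - S.aCh σ| + |S.offCoeff σ k - S.bCh σ|) := by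
      refine (norm_sub_le _ _).trans ?_
      rw [norm_mul, norm_mul, Complex.norm_real, Complex.norm_real, Real.norm_eq_abs,
        Real.norm_eq_abs]
      have := mul_le_mul_of_nonneg_right (by linarith : ‖θ‖ ≤ 5)
        (abs_nonneg (S.diagCoeff σ (k + 1) - S.aCh σ))
      have := mul_le_mul_of_nonneg_left hθ2 (abs_nonneg (S.offCoeff σ k - S.bCh σ))
      linarith
    refine (mul_le_mul h1 (hD k) (inv_pos.2 (S.offCoeff_pos σ k)).le (by positivity)).trans ?_
    rw [mul_comm, ← mul_assoc, mul_comm D]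
    exact mul_le_mul_of_nonneg_left (le_add_of_nonneg_right (abs_nonneg _)) (by positivity)
  · intro k θ hθ
    have hb := S.offCoeff_ne_zero σ k
    have e : S.offCoeff σ (k + 1) * θ ^ 2 / S.offCoeff σ k - θ ^ 2 =
        ((((S.offCoeff σ (k + 1) - S.bCh σ) - (S.offCoeff σ k - S.bCh σ) : ℝ) : ℂ) * θ ^ 2) *
          (((S.offCoeff σ k)⁻¹ : ℝ) : ℂ) := by
      push_cast
      field_simp
      ring
    have hθ2 : ‖θ ^ 2‖ ≤ 5 := by
      rw [norm_pow]
      nlinarith [norm_nonneg θ]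
    rw [e, norm_mul, Complex.norm_real, Real.norm_of_nonneg (inv_pos.2 (S.offCoeff_pos σ k)).le,
      norm_mul, Complex.norm_real, Real.norm_eq_abs]
    have h1 : |(S.offCoeff σ (k + 1) - S.bCh σ) - (S.offCoeff σ k - S.bCh σ)| * ‖θ ^ 2‖ ≤
        (|S.offCoeff σ k - S.bCh σ| + |S.offCoeff σ (k + 1) - S.bCh σ|) * 5 :=
      mul_le_mul ((abs_sub _ _).trans (by linarith)) hθ2 (norm_nonneg _) (by positivity)
    refine (mul_le_mul h1 (hD k) (inv_pos.2 (S.offCoeff_pos σ k)).le (by positivity)).trans ?_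
    have := abs_nonneg (S.diagCoeff σ (k + 1) - S.aCh σ)
    nlinarith [mul_nonneg hD0.le this]
  · intro k
    fun_prop
  · intro k
    fun_prop
  obtain ⟨h, hh1, hh2, hh3⟩ := key
  refine ⟨1 + x, by linarith, fun k θ => θ ^ k * h k θ, fun k => ?_, fun θ hθ hθ0 k => ?_, ?_⟩
  · exact (differentiableOn_id.pow k).mul (hh1 k)
  · have := hh2 k θ hθ
    have hb := S.offCoeff_ne_zero σ k
    simp only [this, lamCh]
    field_simp
    ring
  · intro η hη
    obtain ⟨K, hK⟩ := hh3 η hη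
    refine ⟨K, fun k hk θ hθ => ?_⟩
    rw [← mul_sub_one, norm_mul, norm_pow, mul_comm η]
    exact mul_le_mul_of_nonneg_left (hK k hk θ hθ) (by positivity)

theorem isJostFamily_jost (σ : C) : S.IsJostFamily σ (S.jost σ) := by
  refine Classical.epsilon_spec (p := S.IsJostFamily σ) ?_
  obtain ⟨r, hr, J, h1, h2, h3⟩ := S.exists_jost_extension σ
  have hsub : Metric.closedBall (0 : ℂ) 1 ⊆ Metric.ball 0 r := Metric.closedBall_subset_ball hr
  have hlt : ∀ θ ∈ Metric.closedBall (0 : ℂ) 1, ‖θ‖ < r := fun θ hθ => by simpa using hsub hθ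
  refine ⟨J, fun k => (h1 k).mono (Metric.ball_subset_closedBall.trans hsub),
    fun k => ((h1 k).continuousOn).mono hsub, fun k θ hθ h0 => h2 θ (hlt θ hθ) h0 k, fun η hη => ?_⟩
  obtain ⟨K, hK⟩ := h3 η hη
  exact ⟨K, fun k hk θ hθ => hK k hk θ (hlt θ hθ)⟩

/-- The constant Wronskian of `y - x` and `x` tends to `0` because `|θ| ≤ 1`, so it is `0` and `(y -
x) / x` is constant for large `k`. This ratio tends to `0`, so `y = x` far out, hence everywhere by
backward recursion. The argument covers `|θ| = 1` too, and identifies the chosen `jost` with the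
extension `J`. -/
theorem IsChannelSol.eq_of_asymp {S : WebSystem A C} {σ : C} {z θ : ℂ} {y x : ℕ → ℂ}
    (hy : S.IsChannelSol σ z y) (hx : S.IsChannelSol σ z x) (h0 : θ ≠ 0) (h1 : ‖θ‖ ≤ 1)
    (hya : ∀ η : ℝ, 0 < η → ∃ K : ℕ, ∀ k ≥ K, ‖y k - θ ^ k‖ ≤ η * ‖θ‖ ^ k)
    (hxa : ∀ η : ℝ, 0 < η → ∃ K : ℕ, ∀ k ≥ K, ‖x k - θ ^ k‖ ≤ η * ‖θ‖ ^ k) (k : ℕ) :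
    y k = x k := by
  have ratio : ∀ {u : ℕ → ℂ},
      (∀ η : ℝ, 0 < η → ∃ K : ℕ, ∀ k ≥ K, ‖u k - θ ^ k‖ ≤ η * ‖θ‖ ^ k) →
      Tendsto (fun k => u k / θ ^ k) atTop (𝓝 1) := by
    intro u hu
    refine Metric.tendsto_atTop.2 fun η hη => ?_
    obtain ⟨K, hK⟩ := hu (η / 2) (by linarith)
    refine ⟨K, fun k hk => ?_⟩
    have hk' : θ ^ k ≠ 0 := pow_ne_zero _ h0
    have e : u k / θ ^ k - 1 = (u k - θ ^ k) / θ ^ k := by field_simp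
    rw [dist_eq_norm, e, norm_div, norm_pow]
    have : ‖u k - θ ^ k‖ / ‖θ‖ ^ k ≤ η / 2 := by
      rw [div_le_iff₀ (by positivity)]; exact hK k hk
    linarith
  have hd : S.IsChannelSol σ z (fun k => 1 * y k + (-1) * x k) := hy.smul_add hx 1 (-1)
  have hdr : Tendsto (fun k => (1 * y k + (-1) * x k) / θ ^ k) atTop (𝓝 0) := by
    have := (ratio hya).sub (ratio hxa)
    rw [sub_self] at this
    exact this.congr fun k => by ring
  have hxr := ratio hxa
  have hW : Tendsto (fun k => (S.offCoeff σ k : ℂ) * ((1 * y k + (-1) * x k) * x (k + 1) -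
      (1 * y (k + 1) + (-1) * x (k + 1)) * x k)) atTop (𝓝 0) := by
    have t1 := (hdr.mul ((tendsto_add_atTop_iff_nat 1).2 hxr)).sub
      (((tendsto_add_atTop_iff_nat 1).2 hdr).mul hxr)
    have t2 := ((Complex.continuous_ofReal.tendsto _).comp (S.tendsto_offCoeff σ)).mul t1
    simp only [zero_mul, sub_self, mul_zero] at t2
    refine squeeze_zero_norm (fun k => ?_) (tendsto_zero_iff_norm_tendsto_zero.1 t2)
    have hk' : θ ^ k ≠ 0 := pow_ne_zero _ h0
    have e : (S.offCoeff σ k : ℂ) * ((1 * y k + (-1) * x k) * x (k + 1) -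
        (1 * y (k + 1) + (-1) * x (k + 1)) * x k) = (θ ^ k * θ ^ (k + 1)) *
        (((Complex.ofReal ∘ S.offCoeff σ) k) *
          ((1 * y k + -1 * x k) / θ ^ k * (x (k + 1) / θ ^ (k + 1)) -
          (1 * y (k + 1) + -1 * x (k + 1)) / θ ^ (k + 1) * (x k / θ ^ k))) := by
      simp only [Function.comp]
      field_simp
    rw [e, norm_mul, norm_mul (θ ^ k), norm_pow, norm_pow]
    refine mul_le_of_le_one_left (norm_nonneg _) ?_
    exact mul_le_one₀ (pow_le_one₀ (norm_nonneg _) h1) (by positivity)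
      (pow_le_one₀ (norm_nonneg _) h1)
  have hW0 : (S.offCoeff σ 0 : ℂ) * ((1 * y 0 + (-1) * x 0) * x 1 -
      (1 * y 1 + (-1) * x 1) * x 0) = 0 :=
    tendsto_nhds_unique (tendsto_const_nhds.congr fun k => (hd.wronskian hx k).symm) hW
  obtain ⟨K, hK⟩ := eventually_atTop.1 (hxr.eventually_ne one_ne_zero)
  have hxne : ∀ k ≥ K, x k ≠ 0 := fun k hk h => hK k hk (by rw [h, zero_div])
  have hconst : ∀ j, (1 * y (K + j) + (-1) * x (K + j)) / x (K + j) =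
      (1 * y K + (-1) * x K) / x K := by
    intro j
    induction j with
    | zero => rfl
    | succ j ih =>
      rw [← ih, div_eq_div_iff (hxne _ (by omega)) (hxne _ (by omega))]
      have := hd.wronskian hx (K + j)
      rw [hW0] at this
      have := (mul_eq_zero.1 this).resolve_left (S.offCoeff_ne_zero σ _)
      rw [← add_assoc]
      linear_combination - this
  have hlim : Tendsto (fun k => (1 * y k + (-1) * x k) / x k) atTop (𝓝 0) := by
    have := hdr.div hxr one_ne_zero
    rw [zero_div] at this
    refine this.congr fun k => ?_
    simp only [Pi.div_apply]
    rw [div_div_div_cancel_right₀ (pow_ne_zero _ h0)]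
  have hc : (1 * y K + (-1) * x K) / x K = 0 := by
    have := (tendsto_add_atTop_iff_nat K).2 hlim
    refine tendsto_nhds_unique (tendsto_const_nhds.congr fun j => ?_) this
    rw [← hconst j, add_comm K j]
  have hz := hd.eq_zero_of_backward K (fun k hk => ?_) k
  · linear_combination hz
  · obtain ⟨j, rfl⟩ := Nat.exists_eq_add_of_le hk
    have := hconst j
    rw [hc] at this
    exact (div_eq_zero_iff.1 this).resolve_right (hxne _ (by omega))

end WebSystem

/-! ### The map `x ↦ x + x⁻¹` and local square roots -/

section Joukowski

theorem eq_of_add_inv_eq {x y : ℂ} (hx : x ≠ 0) (hy : y ≠ 0) (hx1 : ‖x‖ < 1) (hy1 : ‖y‖ < 1)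
    (h : x + x⁻¹ = y + y⁻¹) : x = y := by
  have h2 : (x - y) * (x * y - 1) = 0 := by
    field_simp at h
    linear_combination h
  rcases mul_eq_zero.1 h2 with h3 | h3
  · exact sub_eq_zero.1 h3
  · exfalso
    have h4 : ‖x‖ * ‖y‖ = 1 := by rw [← norm_mul, sub_eq_zero.1 h3, norm_one]
    nlinarith [norm_nonneg x, norm_nonneg y]

theorem add_inv_eq_of_norm_eq_one {x : ℂ} (hx : ‖x‖ = 1) :
    x + x⁻¹ = ((2 * x.re : ℝ) : ℂ) ∧ |2 * x.re| ≤ 2 := by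
  refine ⟨?_, ?_⟩
  · rw [Complex.inv_eq_conj hx, Complex.add_conj]
  · rw [abs_mul, abs_two]
    linarith [Complex.abs_re_le_norm x]

theorem norm_eq_one_of_add_inv_eq {x : ℂ} {s : ℝ} (hx : x ≠ 0) (h : x + x⁻¹ = s) (hs : |s| ≤ 2) :
    ‖x‖ = 1 := by
  have hn : 0 < Complex.normSq x := Complex.normSq_pos.2 hx
  have h1 := congrArg Complex.im h
  have h2 := congrArg Complex.re h
  simp only [Complex.add_im, Complex.add_re, Complex.inv_im, Complex.inv_re, Complex.ofReal_re,
    Complex.ofReal_im] at h1 h2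
  have hN : Complex.normSq x = 1 := by
    have h3 : x.im * (Complex.normSq x - 1) = 0 := by
      field_simp at h1
      linarith
    rcases mul_eq_zero.1 h3 with h4 | h4
    · have h5 : Complex.normSq x = x.re ^ 2 := by rw [Complex.normSq_apply, h4]; ring
      have hr : x.re ≠ 0 := by
        intro h0
        rw [h5, h0] at hn
        simp at hn
      rw [h5] at h2 ⊢
      have h6 : s * x.re = x.re ^ 2 + 1 := by
        rw [← h2]
        field_simp
      have h7 : s ^ 2 ≤ 4 := by nlinarith [sq_abs s, abs_nonneg s]
      have h8 : (x.re ^ 2 - 1) ^ 2 ≤ 0 := by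
        have : (s * x.re) ^ 2 = (x.re ^ 2 + 1) ^ 2 := by rw [h6]
        nlinarith [sq_nonneg x.re]
      nlinarith [pow_eq_zero_iff (two_ne_zero) |>.1 (le_antisymm h8 (sq_nonneg (x.re ^ 2 - 1)))]
    · linarith
  have : ‖x‖ ^ 2 = 1 := by rw [← Complex.normSq_eq_norm_sq, hN]
  exact (pow_eq_one_iff_of_nonneg (norm_nonneg _) two_ne_zero).1 this

/-- The roots of `x² - s x + 1` have product `1`, so one lies in the open disk unless both are on
the circle, where `s` would be in `[-2, 2]`. -/
theorem exists_add_inv_eq {s : ℂ} (hs : ∀ x : ℝ, |x| ≤ 2 → s ≠ x) :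
    ∃ x : ℂ, ‖x‖ < 1 ∧ x ≠ 0 ∧ x + x⁻¹ = s := by
  obtain ⟨q, hq⟩ := IsAlgClosed.exists_pow_nat_eq (s ^ 2 - 4) (zero_lt_two)
  have hp : ((s + q) / 2) * ((s - q) / 2) = 1 := by linear_combination - hq / 4
  have h0 : (s + q) / 2 ≠ 0 := left_ne_zero_of_mul_eq_one hp
  have h0' : (s - q) / 2 ≠ 0 := right_ne_zero_of_mul_eq_one hp
  have e : (s + q) / 2 + ((s + q) / 2)⁻¹ = s := by
    rw [← eq_inv_of_mul_eq_one_right hp]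
    ring
  have e' : (s - q) / 2 + ((s - q) / 2)⁻¹ = s := by
    rw [← eq_inv_of_mul_eq_one_left hp]
    ring
  have hn : ‖(s + q) / 2‖ * ‖(s - q) / 2‖ = 1 := by rw [← norm_mul, hp, norm_one]
  rcases lt_trichotomy ‖(s + q) / 2‖ 1 with h | h | h
  · exact ⟨_, h, h0, e⟩
  · have := add_inv_eq_of_norm_eq_one h
    exact absurd (e.symm.trans this.1) (hs _ this.2)
  · refine ⟨_, ?_, h0', e'⟩
    by_contra! h'
    nlinarith

theorem AnalyticAt.exists_sqrt {f : ℂ → ℂ} {w : ℂ} (hf : AnalyticAt ℂ f w) (h0 : f w ≠ 0) :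
    ∃ q : ℂ → ℂ, AnalyticAt ℂ q w ∧ ∀ᶠ ω in 𝓝 w, q ω ^ 2 = f ω := by
  obtain ⟨c, hc⟩ := IsAlgClosed.exists_pow_nat_eq (f w) (zero_lt_two)
  refine ⟨fun ω => c * Complex.exp (Complex.log (f ω / f w) / 2), ?_, ?_⟩
  · have h1 : AnalyticAt ℂ (fun ω => Complex.log (f ω / f w)) w := by
      refine (hf.div analyticAt_const h0).clog ?_
      simp only [Pi.div_apply, div_self h0]
      exact Complex.one_mem_slitPlane
    exact analyticAt_const.mul ((h1.div analyticAt_const two_ne_zero).cexp)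
  · filter_upwards [hf.continuousAt.eventually_ne h0] with ω hω
    rw [mul_pow, hc, ← Complex.exp_nat_mul]
    push_cast
    rw [mul_div_cancel₀ _ two_ne_zero, Complex.exp_log (div_ne_zero hω h0)]
    field_simp

end Joukowski

/-! ### The channel parameter `θ_σ` and its continuation -/

namespace WebSystem

variable {A C : Type*} (S : WebSystem A C)

theorem channel_interval_le (σ : C) :
    S.a - 2 * S.b ≤ S.aCh σ - 2 * S.bCh σ ∧ S.aCh σ + 2 * S.bCh σ ≤ S.a + 2 * S.b := by
  have hb := S.bCh_pos σ
  have h : Set.Icc (S.aCh σ - 2 * S.bCh σ) (S.aCh σ + 2 * S.bCh σ) ⊆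
      Set.Icc (S.a - 2 * S.b) (S.a + 2 * S.b) := by
    rw [← S.union_eq]
    exact Set.subset_iUnion (fun σ => Set.Icc (S.aCh σ - 2 * S.bCh σ) (S.aCh σ + 2 * S.bCh σ)) σ
  exact ⟨(h ⟨le_rfl, by linarith⟩).1, (h ⟨by linarith, le_rfl⟩).2⟩

theorem b_pos (σ : C) : 0 < S.b := by
  have := S.channel_interval_le σ
  have := S.bCh_pos σ
  linarith

theorem lamCh_eq_iff (σ : C) (θ z : ℂ) :
    S.lamCh σ θ = z ↔ θ + θ⁻¹ = ((S.aCh σ : ℂ) - z) / S.bCh σ := by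
  have hb : (S.bCh σ : ℂ) ≠ 0 := Complex.ofReal_ne_zero.2 (S.bCh_pos σ).ne'
  rw [lamCh, eq_div_iff hb]
  constructor <;> intro h <;> linear_combination - h

theorem lam_im (ω : ℂ) : (S.lam ω).im = S.b * ω.im * ((Complex.normSq ω)⁻¹ - 1) := by
  simp only [lam, Complex.sub_im, Complex.mul_im, Complex.add_im, Complex.inv_im,
    Complex.ofReal_re, Complex.ofReal_im]
  ring

theorem lam_im_ne_zero (σ : C) {ω : ℂ} (h1 : ‖ω‖ < 1) (hi : ω.im ≠ 0) : (S.lam ω).im ≠ 0 := by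
  rw [lam_im]
  have h0 : ω ≠ 0 := fun h => hi (by simp [h])
  have hn : 0 < Complex.normSq ω := Complex.normSq_pos.2 h0
  refine mul_ne_zero (mul_ne_zero (S.b_pos σ).ne' hi) (sub_pos.2 ?_).ne'
  rw [Complex.normSq_eq_norm_sq] at hn ⊢
  exact (one_lt_inv₀ hn).2 (by nlinarith [norm_nonneg ω])

/-- In the punctured open disk, `λ` avoids the spectrum of every channel. -/
theorem lam_ne_of_norm_lt_one (σ : C) {ω : ℂ} (h0 : ω ≠ 0) (h1 : ‖ω‖ < 1) {x : ℝ}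
    (hx : |x| ≤ 2) : ((S.aCh σ : ℂ) - S.lam ω) / S.bCh σ ≠ x := by
  intro h
  have hb : (S.bCh σ : ℂ) ≠ 0 := Complex.ofReal_ne_zero.2 (S.bCh_pos σ).ne'
  have hbb : (S.b : ℂ) ≠ 0 := Complex.ofReal_ne_zero.2 (S.b_pos σ).ne'
  rw [div_eq_iff hb] at h
  have hlt := S.b_pos σ
  have e : ω + ω⁻¹ = (((S.a - S.aCh σ + x * S.bCh σ) / S.b : ℝ) : ℂ) := by
    push_cast
    rw [eq_div_iff hbb]
    simp only [lam] at h
    linear_combination h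
  have := norm_eq_one_of_add_inv_eq h0 e (by
    have := S.channel_interval_le σ
    have hb := S.bCh_pos σ
    have hx' := abs_le.1 hx
    rw [abs_div, abs_of_pos hlt, div_le_iff₀ hlt, abs_le]
    constructor <;> nlinarith)
  linarith

theorem theta_spec (σ : C) {ω : ℂ} (h0 : ω ≠ 0) (h1 : ‖ω‖ < 1) :
    ‖S.theta σ ω‖ < 1 ∧ S.theta σ ω ≠ 0 ∧ S.lamCh σ (S.theta σ ω) = S.lam ω := by
  obtain ⟨x, hx1, hx0, hx⟩ :=
    exists_add_inv_eq fun x hx => S.lam_ne_of_norm_lt_one σ h0 h1 hx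
  have hex : ∃ θ ∈ {θ : ℂ | ‖θ‖ < 1 ∧ θ ≠ 0}, S.lamCh σ θ = S.lam ω :=
    ⟨x, ⟨hx1, hx0⟩, (S.lamCh_eq_iff σ x _).2 hx⟩
  rw [theta, if_neg h0]
  have := Function.invFunOn_mem hex
  exact ⟨this.1, this.2, Function.invFunOn_eq hex⟩

theorem theta_eq (σ : C) {ω θ : ℂ} (h0 : ω ≠ 0) (h1 : ‖ω‖ < 1) (hθ0 : θ ≠ 0) (hθ1 : ‖θ‖ < 1)
    (h : S.lamCh σ θ = S.lam ω) : θ = S.theta σ ω := by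
  obtain ⟨h2, h3, h4⟩ := S.theta_spec σ h0 h1
  refine eq_of_add_inv_eq hθ0 h3 hθ1 h2 ?_
  rw [(S.lamCh_eq_iff σ _ _).1 h, (S.lamCh_eq_iff σ _ _).1 h4]

theorem analyticAt_lam {w : ℂ} (hw0 : w ≠ 0) : AnalyticAt ℂ S.lam w := by
  unfold lam
  exact analyticAt_const.sub (analyticAt_const.mul (analyticAt_id.add (analyticAt_id.inv hw0)))

/-- With `s = (a_σ - λ) / b_σ`, the candidates are `(s ± √(s² - 4)) / 2`, analytic near `w` because
the discriminant vanishes only at thresholds. It remains to choose the sign consistently over the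
part of the disk near `w`. -/
theorem exists_theta_extension (σ : C) {w : ℂ} (hw : ‖w‖ ≤ 1) (hw0 : w ≠ 0)
    (hthr : S.lam w ≠ ((S.aCh σ - 2 * S.bCh σ : ℝ) : ℂ) ∧
      S.lam w ≠ ((S.aCh σ + 2 * S.bCh σ : ℝ) : ℂ)) :
    ∃ Θ : ℂ → ℂ, AnalyticAt ℂ Θ w ∧ Θ w ≠ 0 ∧ ‖Θ w‖ ≤ 1 ∧
      (∀ᶠ ω in 𝓝 w, ‖ω‖ < 1 → Θ ω = S.theta σ ω) ∧
      ∀ᶠ ω in 𝓝 w, Θ ω ≠ 0 ∧ S.lamCh σ (Θ ω) = S.lam ω := by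
  have hb : (S.bCh σ : ℂ) ≠ 0 := Complex.ofReal_ne_zero.2 (S.bCh_pos σ).ne'
  obtain ⟨s, hs⟩ : ∃ s : ℂ → ℂ, s = fun ω => ((S.aCh σ : ℂ) - S.lam ω) / S.bCh σ := ⟨_, rfl⟩
  have hsa : AnalyticAt ℂ s w := by
    rw [hs]
    exact (analyticAt_const.sub (S.analyticAt_lam hw0)).div analyticAt_const hb
  have hs4 : s w ^ 2 - 4 ≠ 0 := by
    intro h
    have h' : (s w - 2) * (s w + 2) = 0 := by linear_combination h
    simp only [hs] at h'
    rcases mul_eq_zero.1 h' with h | h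
    · refine hthr.1 ?_
      field_simp at h
      push_cast
      linear_combination - h
    · refine hthr.2 ?_
      field_simp at h
      push_cast
      linear_combination - h
  obtain ⟨q, hq, hq2⟩ := AnalyticAt.exists_sqrt (f := fun ω => s ω ^ 2 - 4)
    ((hsa.pow 2).sub analyticAt_const) hs4
  have hroot : ∀ {ω Q}, Q ^ 2 = s ω ^ 2 - 4 → (s ω + Q) / 2 * ((s ω - Q) / 2) = 1 := by
    intro ω Q h
    linear_combination - h / 4
  have hlam : ∀ {ω Q}, Q ^ 2 = s ω ^ 2 - 4 → (s ω + Q) / 2 ≠ 0 ∧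
      S.lamCh σ ((s ω + Q) / 2) = S.lam ω := by
    intro ω Q h
    have hp := hroot h
    refine ⟨left_ne_zero_of_mul_eq_one hp, (S.lamCh_eq_iff σ _ _).2 ?_⟩
    rw [← eq_inv_of_mul_eq_one_right hp]
    simp only [hs]
    ring
  have main : ∀ Q : ℂ → ℂ, AnalyticAt ℂ Q w → (∀ᶠ ω in 𝓝 w, Q ω ^ 2 = s ω ^ 2 - 4) →
      (∀ᶠ ω in 𝓝 w, ‖ω‖ < 1 → ‖(s ω + Q ω) / 2‖ < 1) →
      ∃ Θ : ℂ → ℂ, AnalyticAt ℂ Θ w ∧ Θ w ≠ 0 ∧ ‖Θ w‖ ≤ 1 ∧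
      (∀ᶠ ω in 𝓝 w, ‖ω‖ < 1 → Θ ω = S.theta σ ω) ∧
      ∀ᶠ ω in 𝓝 w, Θ ω ≠ 0 ∧ S.lamCh σ (Θ ω) = S.lam ω := by
    intro Q hQ hQ2 hlt
    have ha : AnalyticAt ℂ (fun ω => (s ω + Q ω) / 2) w :=
      (hsa.add hQ).div analyticAt_const two_ne_zero
    refine ⟨fun ω => (s ω + Q ω) / 2, ha, (hlam hQ2.self_of_nhds).1, ?_, ?_, ?_⟩
    · have hcl : w ∈ closure (Metric.ball (0 : ℂ) 1) := by
        rw [closure_ball _ one_ne_zero]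
        simpa using hw
      have := mem_closure_iff_nhdsWithin_neBot.1 hcl
      refine le_of_tendsto (ha.continuousAt.norm.tendsto.mono_left
        (nhdsWithin_le_nhds (s := Metric.ball (0 : ℂ) 1))) ?_
      filter_upwards [hlt.filter_mono nhdsWithin_le_nhds, self_mem_nhdsWithin] with ω h1 h2
      exact (h1 (by simpa using h2)).le
    · filter_upwards [hQ2, hlt, eventually_ne_nhds hw0] with ω h1 h2 h3 h4
      exact S.theta_eq σ h3 h4 (hlam h1).1 (h2 h4) (hlam h1).2
    · filter_upwards [hQ2] with ω h1
      exact hlam h1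
  obtain ⟨δ, hδ, hball⟩ := Metric.eventually_nhds_iff_ball.1
    ((hq2.and hq.eventually_analyticAt).and (hsa.eventually_analyticAt.and (eventually_ne_nhds hw0)))
  -- The modulus of a root never equals `1` on this convex, hence connected, set. So it stays on one
  -- side of `1`, and if the side is wrong, the other root, its inverse, is `θ_σ`.
  have hne : ∀ ω ∈ Metric.ball w δ ∩ Metric.ball 0 1, ‖(s ω + q ω) / 2‖ ≠ 1 := by
    rintro ω ⟨h1, h2⟩ h3
    have h4 := add_inv_eq_of_norm_eq_one h3
    have h5 := (S.lamCh_eq_iff σ _ _).1 (hlam (hball ω h1).1.1).2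
    exact S.lam_ne_of_norm_lt_one σ (hball ω h1).2.2 (by simpa using h2) h4.2 (h5.symm.trans h4.1)
  have hconn : IsPreconnected (Metric.ball w δ ∩ Metric.ball (0 : ℂ) 1) :=
    ((convex_ball w δ).inter (convex_ball 0 1)).isPreconnected
  have hcont : ContinuousOn (fun ω => ‖(s ω + q ω) / 2‖) (Metric.ball w δ ∩ Metric.ball 0 1) := by
    intro ω hω
    have h := hball ω hω.1
    exact (((h.2.1.add h.1.2).div analyticAt_const two_ne_zero).continuousAt.norm).continuousWithinAt
  have hmem : ∀ {ω : ℂ}, ω ∈ Metric.ball w δ → ‖ω‖ < 1 → ω ∈ Metric.ball w δ ∩ Metric.ball 0 1 :=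
    fun h1 h2 => ⟨h1, by simpa using h2⟩
  by_cases hall : ∀ ω ∈ Metric.ball w δ ∩ Metric.ball 0 1, ‖(s ω + q ω) / 2‖ < 1
  · refine main q hq hq2 ?_
    filter_upwards [Metric.ball_mem_nhds w hδ] with ω h1 h2
    exact hall ω (hmem h1 h2)
  · push Not at hall
    obtain ⟨ω₀, hω₀, hge⟩ := hall
    refine main (-q) hq.neg (hq2.mono fun ω h => by simpa using h) ?_
    filter_upwards [Metric.ball_mem_nhds w hδ] with ω h1 h2
    have hω := hmem h1 h2
    have hgt : 1 < ‖(s ω + q ω) / 2‖ := by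
      by_contra! hle
      obtain ⟨x, hx, hx1⟩ := hconn.intermediate_value hω hω₀ hcont ⟨hle, hge⟩
      exact hne x hx hx1
    have hn : ‖(s ω + q ω) / 2‖ * ‖(s ω - q ω) / 2‖ = 1 := by
      rw [← norm_mul, hroot (hball ω h1).1.1, norm_one]
    simp only [Pi.neg_apply, ← sub_eq_add_neg]
    by_contra! h'
    nlinarith

end WebSystem

/-! ### Continuation of the Jost solutions, and the central part -/

namespace WebSystem

variable {A C : Type*} (S : WebSystem A C)

/-- Near `w`, the functions `e σ k` and `d σ` analytically continue `e_σ(k, θ_σ(ω))` and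
`θ_σ(ω)⁻¹ - θ_σ(ω)` from the open unit disk. -/
structure IsLocalJost (w : ℂ) (e : C → ℕ → ℂ → ℂ) (d : C → ℂ → ℂ) : Prop where
  analytic : ∀ σ k, AnalyticAt ℂ (e σ k) w
  analytic_d : ∀ σ, AnalyticAt ℂ (d σ) w
  sol : ∀ σ, ∀ᶠ ω in 𝓝 w, S.IsChannelSol σ (S.lam ω) fun k => e σ k ω
  eq_jost : ∀ σ, ∀ᶠ ω in 𝓝 w, ‖ω‖ < 1 → ∀ k, e σ k ω = S.jost σ k (S.theta σ ω)
  eq_d : ∀ σ, ∀ᶠ ω in 𝓝 w, ‖ω‖ < 1 → d σ ω = (S.theta σ ω)⁻¹ - S.theta σ ω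
  tendsto_zero : ∀ σ, ∀ᶠ ω in 𝓝 w, ‖ω‖ < 1 → Tendsto (fun k => e σ k ω) atTop (𝓝 0)
  exists_ne : ∀ σ, ∃ k, e σ (k + 1) w ≠ 0
  dichotomy : ∀ σ, (w ∉ S.TPlus σ ∧ Summable fun k => ‖e σ (k + 1) w‖ ^ 2) ∨
    (‖w‖ = 1 ∧ ¬ Summable fun k => ‖e σ (k + 1) w‖ ^ 2)

theorem tendsto_zero_of_asymp {y : ℕ → ℂ} {θ : ℂ} (hθ : ‖θ‖ < 1)
    (h : ∃ K : ℕ, ∀ k ≥ K, ‖y k - θ ^ k‖ ≤ (1 / 2 : ℝ) * ‖θ‖ ^ k) : Tendsto y atTop (𝓝 0) := by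
  obtain ⟨K, hK⟩ := h
  have h1 : Tendsto (fun k => y k - θ ^ k) atTop (𝓝 0) := by
    have h2 := (tendsto_pow_atTop_nhds_zero_of_lt_one (norm_nonneg θ) hθ).const_mul (1 / 2 : ℝ)
    rw [mul_zero] at h2
    exact squeeze_zero_norm' (eventually_atTop.2 ⟨K, hK⟩) h2
  simpa using h1.add (tendsto_pow_atTop_nhds_zero_of_norm_lt_one hθ)

theorem norm_ge_of_asymp {y θ : ℂ} {k : ℕ} (h : ‖y - θ ^ k‖ ≤ (1 / 2 : ℝ) * ‖θ‖ ^ k) :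
    (1 / 2 : ℝ) * ‖θ‖ ^ k ≤ ‖y‖ ∧ ‖y‖ ≤ (3 / 2 : ℝ) * ‖θ‖ ^ k := by
  have h1 := norm_sub_norm_le (θ ^ k) y
  have h2 := norm_sub_norm_le y (θ ^ k)
  rw [norm_sub_rev] at h1
  rw [norm_pow] at h1 h2
  constructor <;> linarith

/-- Compose the extended Jost solution `J` with the continuation `Θ` of `θ_σ`. Since `|J k (Θ w)|`
is comparable to `|Θ w| ^ k` for large `k`, the two cases of the final alternative are `|Θ w| < 1`
and `|Θ w| = 1`. -/
theorem exists_isLocalJost_channel (σ : C) {w : ℂ} (hw : ‖w‖ ≤ 1) (hw0 : w ≠ 0)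
    (hthr : S.lam w ≠ ((S.aCh σ - 2 * S.bCh σ : ℝ) : ℂ) ∧
      S.lam w ≠ ((S.aCh σ + 2 * S.bCh σ : ℝ) : ℂ)) :
    ∃ (e : ℕ → ℂ → ℂ) (d : ℂ → ℂ), (∀ k, AnalyticAt ℂ (e k) w) ∧ AnalyticAt ℂ d w ∧
      (∀ᶠ ω in 𝓝 w, S.IsChannelSol σ (S.lam ω) fun k => e k ω) ∧
      (∀ᶠ ω in 𝓝 w, ‖ω‖ < 1 → ∀ k, e k ω = S.jost σ k (S.theta σ ω)) ∧
      (∀ᶠ ω in 𝓝 w, ‖ω‖ < 1 → d ω = (S.theta σ ω)⁻¹ - S.theta σ ω) ∧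
      (∀ᶠ ω in 𝓝 w, ‖ω‖ < 1 → Tendsto (fun k => e k ω) atTop (𝓝 0)) ∧
      (∃ k, e (k + 1) w ≠ 0) ∧
      ((w ∉ S.TPlus σ ∧ Summable fun k => ‖e (k + 1) w‖ ^ 2) ∨
        (‖w‖ = 1 ∧ ¬ Summable fun k => ‖e (k + 1) w‖ ^ 2)) := by
  obtain ⟨Θ, hΘ, hΘ0, hΘ1, hΘt, hΘl⟩ := S.exists_theta_extension σ hw hw0 hthr
  obtain ⟨r, hr, J, hJ1, hJ2, hJ3⟩ := S.exists_jost_extension σ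
  have hΘr : ∀ᶠ ω in 𝓝 w, ‖Θ ω‖ < r :=
    hΘ.continuousAt.norm.eventually_lt_const (lt_of_le_of_lt hΘ1 hr)
  have hwr : ‖Θ w‖ < r := lt_of_le_of_lt hΘ1 hr
  obtain ⟨K, hK⟩ := hJ3 (1 / 2) (by norm_num)
  have hnw : ∀ k ≥ K, (1 / 2 : ℝ) * ‖Θ w‖ ^ k ≤ ‖J k (Θ w)‖ ∧
      ‖J k (Θ w)‖ ≤ (3 / 2 : ℝ) * ‖Θ w‖ ^ k :=
    fun k hk => norm_ge_of_asymp (hK k hk _ hwr)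
  refine ⟨fun k ω => J k (Θ ω), fun ω => (Θ ω)⁻¹ - Θ ω, fun k => ?_, (hΘ.inv hΘ0).sub hΘ,
    ?_, ?_, ?_, ?_, ⟨K, ?_⟩, ?_⟩
  · have : AnalyticAt ℂ (J k) (Θ w) :=
      (hJ1 k).analyticAt (Metric.isOpen_ball.mem_nhds (by simpa using hwr))
    exact this.comp hΘ
  · filter_upwards [hΘr, hΘl] with ω h1 h2
    have := hJ2 (Θ ω) h1 h2.1
    rwa [h2.2] at this
  · filter_upwards [hΘr, hΘl, hΘt, eventually_ne_nhds hw0] with ω h1 h2 h3 h4 h5 k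
    obtain ⟨h6, h7, h8⟩ := S.theta_spec σ h4 h5
    have hf := S.isJostFamily_jost σ
    have hm : S.theta σ ω ∈ Metric.closedBall (0 : ℂ) 1 := by simpa using h6.le
    rw [h3 h5] at h1 ⊢
    refine IsChannelSol.eq_of_asymp (hJ2 _ h1 h7) (fun k => hf.eqn k _ hm h7) h7 h6.le
      (fun η hη => ?_) (fun η hη => ?_) k
    · obtain ⟨K', hK'⟩ := hJ3 η hη
      exact ⟨K', fun k hk => hK' k hk _ h1⟩
    · obtain ⟨K', hK'⟩ := hf.asymp η hη
      exact ⟨K', fun k hk => hK' k hk _ hm⟩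
  · filter_upwards [hΘt] with ω h1 h2
    rw [h1 h2]
  · filter_upwards [hΘr, hΘt, eventually_ne_nhds hw0] with ω h1 h3 h4 h5
    refine tendsto_zero_of_asymp (θ := Θ ω) ?_ ⟨K, fun k hk => hK k hk _ h1⟩
    rw [h3 h5]
    exact (S.theta_spec σ h4 h5).1
  · have h1 := (hnw (K + 1) (by omega)).1
    have h2 : 0 < (1 / 2 : ℝ) * ‖Θ w‖ ^ (K + 1) := by positivity
    exact norm_pos_iff.1 (h2.trans_le h1)
  · rcases hΘ1.lt_or_eq with hlt | heq
    · refine Or.inl ⟨fun hT => ?_, ?_⟩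
      -- The boundary value of `θ_σ` at `w` is `Θ w`, so `w ∈ T_σ⁺` would force `|Θ w| = 1`.
      · have hcl : w ∈ closure (Metric.ball (0 : ℂ) 1) := by
          rw [closure_ball _ one_ne_zero]
          simpa using hw
        have hlim : Tendsto (S.theta σ) (𝓝[Metric.ball (0 : ℂ) 1] w) (𝓝 (Θ w)) := by
          refine (hΘ.continuousAt.tendsto.mono_left nhdsWithin_le_nhds).congr' ?_
          filter_upwards [hΘt.filter_mono nhdsWithin_le_nhds, self_mem_nhdsWithin] with ω h1 h2
          exact h1 (by simpa using h2)
        have := hT.2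
        rw [extendFrom_eq hcl hlim] at this
        linarith
      · refine (summable_nat_add_iff (K + 1)).1 ?_
        have hg : Summable fun k : ℕ => (3 / 2 : ℝ) ^ 2 * (‖Θ w‖ ^ 2) ^ k :=
          (summable_geometric_of_lt_one (by positivity) (by nlinarith [norm_nonneg (Θ w)])).mul_left _
        refine Summable.of_nonneg_of_le (fun k => by positivity) (fun k => ?_) hg
        rw [← pow_mul, mul_comm 2 k, pow_mul, ← mul_pow]
        refine pow_le_pow_left₀ (norm_nonneg _) ((hnw _ (by omega)).2.trans ?_) 2
        gcongr ?_ * ?_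
        exact pow_le_pow_of_le_one (norm_nonneg _) hΘ1 (by omega)
    · refine Or.inr ⟨?_, fun hs => ?_⟩
      · refine hw.eq_of_not_lt fun hlt => ?_
        have := (S.theta_spec σ hw0 hlt).1
        rw [← hΘt.self_of_nhds hlt] at this
        linarith
      · have ht := hs.tendsto_atTop_zero
        have hge : ∀ᶠ k in atTop, (1 / 2 : ℝ) ^ 2 ≤ ‖J (k + 1) (Θ w)‖ ^ 2 := by
          refine eventually_atTop.2 ⟨K, fun k hk => ?_⟩
          have := (hnw (k + 1) (by omega)).1
          rw [heq, one_pow, mul_one] at this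
          exact pow_le_pow_left₀ (by norm_num) this 2
        have := ge_of_tendsto ht hge
        norm_num at this

theorem exists_isLocalJost {w : ℂ} (hw : ‖w‖ ≤ 1) (hw0 : w ≠ 0)
    (hthr : ∀ γ, S.lam w ≠ ((S.aCh γ - 2 * S.bCh γ : ℝ) : ℂ) ∧
      S.lam w ≠ ((S.aCh γ + 2 * S.bCh γ : ℝ) : ℂ)) :
    ∃ e d, S.IsLocalJost w e d := by
  choose e d h1 h2 h3 h4 h5 h6 h7 h8 using
    fun σ => S.exists_isLocalJost_channel σ hw hw0 (hthr σ)
  exact ⟨e, d, h1, h2, h3, h4, h5, h6, h7, h8⟩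

theorem IsChannelSol.zero_or_one_ne {S : WebSystem A C} {σ : C} {z : ℂ} {y : ℕ → ℂ}
    (h : S.IsChannelSol σ z y) (hne : ∃ k, y (k + 1) ≠ 0) : y 0 ≠ 0 ∨ y 1 ≠ 0 := by
  by_contra! h0
  obtain ⟨k, hk⟩ := hne
  exact hk (h.eq_zero_of_forward h0.1 h0.2 _)

section Central

theorem L₁_form_im (x : S.central → ℂ) :
    (∑ α, (starRingEnd ℂ) (x α) * (S.L₁.mulVec x) α).im = 0 := by
  have h : (starRingEnd ℂ) (∑ α, (starRingEnd ℂ) (x α) * (S.L₁.mulVec x) α) =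
      ∑ α, (starRingEnd ℂ) (x α) * (S.L₁.mulVec x) α := by
    simp only [Matrix.mulVec, dotProduct, Finset.mul_sum, map_sum, map_mul, Complex.conj_conj]
    rw [Finset.sum_comm]
    refine Finset.sum_congr rfl fun α _ => Finset.sum_congr rfl fun β _ => ?_
    simp only [L₁, Matrix.of_apply, Complex.conj_ofReal]
    rw [S.symm β α]
    ring
  exact Complex.conj_eq_iff_im.1 h

open Classical in
/-- The resolvent of the central part. -/
noncomputable def resolvent₁ (z : ℂ) : Matrix S.central S.central ℂ :=
  (S.L₁ - Matrix.scalar S.central z)⁻¹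

open Classical in
/-- The characteristic determinant of the central part. -/
noncomputable def det₁ (z : ℂ) : ℂ := (S.L₁ - Matrix.scalar S.central z).det

theorem R_apply (z : ℂ) (σ ν : C) :
    S.R z σ ν = S.resolvent₁ z (S.attach σ) (S.attach ν) := rfl

variable [Fintype C]

/-- `(L₁ - z) x = ι B(0) v`, where `ι` places the entry of index `σ` at the particle `σ(0)`. -/
def IsCentralSol (z : ℂ) (x : S.central → ℂ) (v : C → ℂ) : Prop :=
  open Classical in
  ∀ α, (S.L₁.mulVec x) α = z * x α +
    ∑ σ, if S.attach σ = α then (S.offCoeff σ 0 : ℂ) * v σ else 0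

/-- The form of the real symmetric matrix `L₁` is real. Its imaginary part, computed from the
equation, balances absorption in the central part against the flux into the channels. -/
theorem IsCentralSol.energy {S : WebSystem A C} {z : ℂ} {x : S.central → ℂ} {v : C → ℂ}
    (h : S.IsCentralSol z x v) :
    z.im * ∑ α, ‖x α‖ ^ 2 +
      ∑ σ, S.offCoeff σ 0 * ((starRingEnd ℂ) (x (S.attach σ)) * v σ).im = 0 := by
  classical
  have h1 := S.L₁_form_im x
  have e : ∑ α, (starRingEnd ℂ) (x α) * (S.L₁.mulVec x) α =
      z * ((∑ α, ‖x α‖ ^ 2 : ℝ) : ℂ) +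
        ∑ σ, (S.offCoeff σ 0 : ℂ) * ((starRingEnd ℂ) (x (S.attach σ)) * v σ) := by
    simp only [h _, mul_add, Finset.sum_add_distrib, Finset.mul_sum, Complex.ofReal_sum]
    congr 1
    · refine Finset.sum_congr rfl fun α _ => ?_
      rw [mul_left_comm, mul_comm ((starRingEnd ℂ) (x α)), Complex.mul_conj,
        Complex.normSq_eq_norm_sq]
    · rw [Finset.sum_comm]
      refine Finset.sum_congr rfl fun σ _ => ?_
      rw [Finset.sum_eq_single (S.attach σ)]
      · simp only [if_true]; ring
      · intro α _ hα
        rw [if_neg fun h => hα h.symm, mul_zero]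
      · simp
  rw [e] at h1
  rw [Complex.add_im, Complex.im_mul_ofReal, Complex.im_sum] at h1
  simpa only [Complex.im_ofReal_mul] using h1

theorem det₁_ne_zero {z : ℂ} (hz : z.im ≠ 0) : S.det₁ z ≠ 0 := by
  classical
  intro h
  unfold det₁ at h
  obtain ⟨x, hx0, hx⟩ := Matrix.exists_mulVec_eq_zero_iff.2 h
  have hs : S.IsCentralSol z x 0 := by
    intro α
    have := congrFun hx α
    rw [Matrix.sub_mulVec] at this
    simp only [Pi.sub_apply, Pi.zero_apply, Matrix.scalar_apply, Matrix.mulVec_diagonal] at this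
    simp only [Pi.zero_apply, mul_zero, ite_self, Finset.sum_const_zero, add_zero]
    exact sub_eq_zero.1 this
  have he := hs.energy
  simp only [Pi.zero_apply, mul_zero, Complex.zero_im, Finset.sum_const_zero, add_zero] at he
  have h0 := (mul_eq_zero.1 he).resolve_left hz
  rw [Finset.sum_eq_zero_iff_of_nonneg fun _ _ => by positivity] at h0
  refine hx0 (funext fun α => ?_)
  simpa using h0 α (Finset.mem_univ α)

theorem isCentralSol_resolvent₁ {z : ℂ} (hz : S.det₁ z ≠ 0) (v : C → ℂ) :
    S.IsCentralSol z
      (fun α => ∑ σ, S.resolvent₁ z α (S.attach σ) * ((S.offCoeff σ 0 : ℂ) * v σ)) v := by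
  classical
  intro α
  have hinv : (S.L₁ - Matrix.scalar S.central z) * S.resolvent₁ z = 1 := by
    unfold resolvent₁
    convert Matrix.mul_nonsing_inv (S.L₁ - Matrix.scalar S.central z) ?_
    refine isUnit_iff_ne_zero.2 ?_
    unfold det₁ at hz
    convert hz
  have hL : S.L₁ * S.resolvent₁ z = z • S.resolvent₁ z + 1 := by
    rw [← hinv, sub_mul, Matrix.scalar_apply, ← Matrix.smul_one_eq_diagonal, smul_mul_assoc,
      one_mul, add_sub_cancel]
  have e : S.L₁.mulVec
      (fun α => ∑ σ, S.resolvent₁ z α (S.attach σ) * ((S.offCoeff σ 0 : ℂ) * v σ)) α =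
      ∑ σ, (S.L₁ * S.resolvent₁ z) α (S.attach σ) * ((S.offCoeff σ 0 : ℂ) * v σ) := by
    simp only [Matrix.mulVec, dotProduct, Matrix.mul_apply, Finset.mul_sum, Finset.sum_mul]
    rw [Finset.sum_comm]
    refine Finset.sum_congr rfl fun _ _ => Finset.sum_congr rfl fun _ _ => ?_
    ring
  rw [e, hL, Finset.mul_sum, ← Finset.sum_add_distrib]
  refine Finset.sum_congr rfl fun σ _ => ?_
  simp only [Matrix.add_apply, Matrix.smul_apply, Matrix.one_apply, smul_eq_mul, add_mul, ite_mul,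
    one_mul, zero_mul, mul_assoc, eq_comm]

end Central

/-! ### Non-degeneracy at non-real spectral parameters -/

section NonReal

theorem IsChannelSol.one_ne_zero_of_im_ne {S : WebSystem A C} {σ : C} {z : ℂ} {y : ℕ → ℂ}
    (h : S.IsChannelSol σ z y) (h0 : Tendsto y atTop (𝓝 0)) (hne : ∃ k, y (k + 1) ≠ 0)
    (hz : z.im ≠ 0) : y 1 ≠ 0 ∧ ∃ G : ℝ, 0 < G ∧ S.flux σ y 0 = z.im * G := by
  obtain ⟨G, hG, hN⟩ := h.flux_zero_eq h0 hz
  obtain ⟨k, hk⟩ := hne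
  have hpos : 0 < G := by
    refine lt_of_lt_of_le ?_ (hN (k + 1))
    rw [Finset.sum_range_succ]
    have : 0 < ‖y (k + 1)‖ ^ 2 := by positivity
    have : 0 ≤ ∑ j ∈ Finset.range k, ‖y (j + 1)‖ ^ 2 := by positivity
    linarith
  refine ⟨fun h1 => ?_, G, hpos, hG⟩
  have : S.flux σ y 0 = 0 := by simp [flux, h1]
  rw [this] at hG
  exact (mul_ne_zero hz hpos.ne') hG.symm

variable [Fintype C] [DecidableEq C]

/-- A kernel vector `v` would glue the decaying solutions `v σ * y σ` to a central solution. In the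
energy identity all terms then carry the sign of `Im z`, so each is zero and `v = 0`. -/
theorem det_ne_zero_of_im_ne {z : ℂ} (hz : z.im ≠ 0) (y : C → ℕ → ℂ)
    (hy : ∀ σ, S.IsChannelSol σ z (y σ)) (h0 : ∀ σ, Tendsto (y σ) atTop (𝓝 0))
    (hne : ∀ σ, ∃ k, y σ (k + 1) ≠ 0) :
    (Matrix.diagonal (fun σ => y σ 0) -
      S.R z * S.B₀ * Matrix.diagonal (fun σ => y σ 1)).det ≠ 0 := by
  intro hdet
  obtain ⟨v, hv0, hv⟩ := Matrix.exists_mulVec_eq_zero_iff.2 hdet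
  have hs := S.isCentralSol_resolvent₁ (S.det₁_ne_zero hz) (fun σ => y σ 1 * v σ)
  have hatt : ∀ σ, ∑ ν, S.resolvent₁ z (S.attach σ) (S.attach ν) *
      ((S.offCoeff ν 0 : ℂ) * (y ν 1 * v ν)) = y σ 0 * v σ := by
    intro σ
    have := congrFun hv σ
    rw [Matrix.sub_mulVec, Pi.sub_apply, Pi.zero_apply, sub_eq_zero, Matrix.mulVec_diagonal] at this
    rw [this]
    simp only [Matrix.mulVec, dotProduct, B₀, Matrix.mul_diagonal, R_apply]
    refine Finset.sum_congr rfl fun ν _ => ?_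
    ring
  have he := hs.energy
  choose G hG hGf using fun σ => ((hy σ).one_ne_zero_of_im_ne (h0 σ) (hne σ) hz).2
  have hterm : ∀ σ, S.offCoeff σ 0 * ((starRingEnd ℂ) (y σ 0 * v σ) * (y σ 1 * v σ)).im =
      z.im * (‖v σ‖ ^ 2 * G σ) := by
    intro σ
    have e : (starRingEnd ℂ) (y σ 0 * v σ) * (y σ 1 * v σ) =
        ((‖v σ‖ ^ 2 : ℝ) : ℂ) * ((starRingEnd ℂ) (y σ 0) * y σ 1) := by
      rw [← Complex.normSq_eq_norm_sq, ← Complex.mul_conj, map_mul]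
      ring
    rw [e, Complex.im_ofReal_mul]
    have := hGf σ
    simp only [flux, zero_add] at this
    linear_combination (‖v σ‖ ^ 2) * this
  simp only [hatt, hterm] at he
  rw [← Finset.mul_sum, ← mul_add] at he
  have h1 := (mul_eq_zero.1 he).resolve_left hz
  have h2 : ∑ σ, ‖v σ‖ ^ 2 * G σ = 0 := by
    have h3 : 0 ≤ ∑ σ, ‖v σ‖ ^ 2 * G σ :=
      Finset.sum_nonneg fun σ _ => mul_nonneg (by positivity) (hG σ).le
    have h4 : 0 ≤ ∑ α, ‖∑ σ, S.resolvent₁ z α (S.attach σ) *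
      ((S.offCoeff σ 0 : ℂ) * (y σ 1 * v σ))‖ ^ 2 := by positivity
    linarith
  rw [Finset.sum_eq_zero_iff_of_nonneg fun σ _ => mul_nonneg (by positivity) (hG σ).le] at h2
  refine hv0 (funext fun σ => ?_)
  have := (mul_eq_zero.1 (h2 σ (Finset.mem_univ σ))).resolve_right (hG σ).ne'
  simpa using this

end NonReal

end WebSystem

/-! ### Meromorphic matrices and isolated zeros -/

section Meromorphic

theorem MeromorphicAt.matrix_det {n : Type*} [Fintype n] [DecidableEq n] {M : ℂ → Matrix n n ℂ}
    {w : ℂ} (h : ∀ i j, MeromorphicAt (fun ω => M ω i j) w) :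
    MeromorphicAt (fun ω => (M ω).det) w := by
  simp only [Matrix.det_apply']
  exact MeromorphicAt.fun_sum fun σ _ =>
    (MeromorphicAt.const _ w).mul (MeromorphicAt.fun_prod fun i _ => h _ _)

theorem MeromorphicAt.matrix_inv {n : Type*} [Fintype n] [DecidableEq n] {M : ℂ → Matrix n n ℂ}
    {w : ℂ} (h : ∀ i j, MeromorphicAt (fun ω => M ω i j) w) (i j : n) :
    MeromorphicAt (fun ω => (M ω)⁻¹ i j) w := by
  simp only [Matrix.inv_def, Ring.inverse_eq_inv', Matrix.smul_apply, smul_eq_mul,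
    Matrix.adjugate_apply]
  refine (MeromorphicAt.matrix_det h).inv.mul (MeromorphicAt.matrix_det fun a b => ?_)
  by_cases ha : a = j
  · subst ha
    simp only [Matrix.updateRow_self]
    exact MeromorphicAt.const _ w
  · simp only [Matrix.updateRow_ne ha]
    exact h a b

/-- A meromorphic function vanishes identically or nowhere on a small punctured neighbourhood, so
non-vanishing needs checking only along one approach, here later through non-real points of the
disk. -/
theorem MeromorphicAt.eventually_ne_zero_of_nhdsWithin {f : ℂ → ℂ} {w : ℂ} {s : Set ℂ}
    [NeBot (𝓝[s] w)] (hf : MeromorphicAt f w) (hs : w ∉ s) (h : ∀ᶠ ω in 𝓝[s] w, f ω ≠ 0) :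
    ∀ᶠ ω in 𝓝[≠] w, f ω ≠ 0 := by
  refine hf.eventually_eq_zero_or_eventually_ne_zero.resolve_left fun h0 => ?_
  have hle : 𝓝[s] w ≤ 𝓝[≠] w := nhdsWithin_mono _ fun ω hω h => hs (h ▸ hω)
  obtain ⟨ω, h1, h2⟩ := ((h0.filter_mono hle).and h).exists
  exact h2 h1

/-- The non-real points of the open unit disk other than `w`. -/
def nonRealDisk (w : ℂ) : Set ℂ := {ω | ‖ω‖ < 1 ∧ ω.im ≠ 0 ∧ ω ≠ w}

theorem nhdsWithin_nonRealDisk_neBot {w : ℂ} (hw : ‖w‖ ≤ 1) : NeBot (𝓝[nonRealDisk w] w) := by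
  refine mem_closure_iff_nhdsWithin_neBot.1 ?_
  have hD : Dense ({ω : ℂ | ω.im ≠ 0} ∩ {w}ᶜ) := by
    refine Dense.inter_of_isOpen_right ?_ (dense_compl_singleton w) isOpen_compl_singleton
    exact (dense_compl_singleton (0 : ℝ)).preimage Complex.isOpenMap_im
  have h1 := hD.open_subset_closure_inter (Metric.isOpen_ball (x := (0 : ℂ)) (ε := 1))
  have h2 : w ∈ closure (Metric.ball (0 : ℂ) 1) := by
    rw [closure_ball _ one_ne_zero]
    simpa using hw
  refine closure_mono ?_ (closure_minimal h1 isClosed_closure h2)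
  rintro ω ⟨h3, h4, h5⟩
  exact ⟨by simpa using h3, h4, h5⟩

end Meromorphic

/-! ### The columns of `U` as meromorphic solutions -/

namespace WebSystem

variable {A C : Type*} (S : WebSystem A C)

theorem analyticAt_pSol (σ : C) {w : ℂ} (hw0 : w ≠ 0) (k : ℕ) :
    AnalyticAt ℂ (fun ω => S.pSol σ (S.lam ω) k) w := by
  have h : ∀ k, AnalyticAt ℂ (fun ω => S.pSol σ (S.lam ω) k) w ∧
      AnalyticAt ℂ (fun ω => S.pSol σ (S.lam ω) (k + 1)) w := by
    intro k
    induction k with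
    | zero => exact ⟨analyticAt_const, analyticAt_const⟩
    | succ k ih =>
      refine ⟨ih.2, ?_⟩
      simp only [pSol]
      exact (((analyticAt_const.sub (S.analyticAt_lam hw0)).mul ih.2).sub
        (analyticAt_const.mul ih.1)).div analyticAt_const (S.offCoeff_ne_zero σ _)
  exact (h k).1

theorem meromorphicAt_L₁_sub {w : ℂ} (hw0 : w ≠ 0) [DecidableEq S.central] (i j : S.central) :
    MeromorphicAt (fun ω => (S.L₁ - Matrix.scalar S.central (S.lam ω)) i j) w := by
  simp only [Matrix.sub_apply, Matrix.scalar_apply, Matrix.diagonal_apply]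
  refine (MeromorphicAt.const _ w).sub ?_
  split_ifs
  · exact (S.analyticAt_lam hw0).meromorphicAt
  · exact MeromorphicAt.const _ w

theorem meromorphicAt_resolvent₁ {w : ℂ} (hw0 : w ≠ 0) (α β : S.central) :
    MeromorphicAt (fun ω => S.resolvent₁ (S.lam ω) α β) w := by
  classical
  unfold resolvent₁
  exact MeromorphicAt.matrix_inv (fun i j => S.meromorphicAt_L₁_sub hw0 i j) α β

theorem meromorphicAt_det₁ {w : ℂ} (hw0 : w ≠ 0) :
    MeromorphicAt (fun ω => S.det₁ (S.lam ω)) w := by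
  classical
  unfold det₁
  exact MeromorphicAt.matrix_det (fun i j => S.meromorphicAt_L₁_sub hw0 i j)

variable [Fintype C]

/-- A meromorphic family of solutions of `L ψ = λ ψ`, with components `x` on the central part and
`y` on the channels, that is proportional to `e` on each channel but `ν`, and whose Wronskian with
`e` on the channel `ν` is the analytic function `κ`. -/
structure IsColumn [DecidableEq C] (w : ℂ) (e : C → ℕ → ℂ → ℂ) (ν : C) (x : S.central → ℂ → ℂ)
    (y : C → ℕ → ℂ → ℂ) (κ : ℂ → ℂ) : Prop where
  mero_x : ∀ α, MeromorphicAt (x α) w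
  mero_y : ∀ σ k, MeromorphicAt (y σ k) w
  analytic : AnalyticAt ℂ κ w
  sol : ∀ σ, ∀ᶠ ω in 𝓝[≠] w, S.IsChannelSol σ (S.lam ω) fun k => y σ k ω
  attach : ∀ σ, ∀ᶠ ω in 𝓝[≠] w, y σ 0 ω = x (S.attach σ) ω
  central : ∀ᶠ ω in 𝓝[≠] w, S.IsCentralSol (S.lam ω) (fun α => x α ω) fun σ => y σ 1 ω
  wronskian : ∀ σ, ∀ᶠ ω in 𝓝[≠] w, (S.offCoeff σ 0 : ℂ) *
    (y σ 0 ω * e σ 1 ω - y σ 1 ω * e σ 0 ω) = if σ = ν then κ ω else 0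

variable [DecidableEq C]

/-- The matrix `T`, with the continuations `e` in place of the Jost solutions. -/
noncomputable def TCont (e : C → ℕ → ℂ → ℂ) (ω : ℂ) : Matrix C C ℂ :=
  Matrix.diagonal (fun σ => e σ 0 ω) -
    S.R (S.lam ω) * S.B₀ * Matrix.diagonal (fun σ => e σ 1 ω)

/-- The entries of the matrices `U`, with the continuations `e`, `d`. -/
noncomputable def UCont (e : C → ℕ → ℂ → ℂ) (d : C → ℂ → ℂ) (σ ν : C) (k : ℕ) (ω : ℂ) : ℂ :=
  (-(if σ = ν then S.pSol ν (S.lam ω) k else 0) + e σ k ω * (S.TCont e ω)⁻¹ σ ν) *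
    (S.bCh ν * (S.offCoeff ν 0 : ℂ)⁻¹ * d ν ω * (e ν 1 ω)⁻¹)

theorem diagonal_inv_of_ne_zero {v : C → ℂ} (h : ∀ σ, v σ ≠ 0) :
    (Matrix.diagonal v)⁻¹ = Matrix.diagonal fun σ => (v σ)⁻¹ := by
  refine Matrix.inv_eq_right_inv ?_
  rw [Matrix.diagonal_mul_diagonal, ← Matrix.diagonal_one]
  congr 1
  funext σ
  exact mul_inv_cancel₀ (h σ)

variable {S}

theorem IsLocalJost.meromorphicAt_TCont {w : ℂ} {e : C → ℕ → ℂ → ℂ} {d : C → ℂ → ℂ}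
    (h : S.IsLocalJost w e d) (hw0 : w ≠ 0) (σ ν : C) :
    MeromorphicAt (fun ω => S.TCont e ω σ ν) w := by
  simp only [TCont, Matrix.sub_apply, B₀, Matrix.mul_diagonal, Matrix.diagonal_apply, R_apply]
  refine MeromorphicAt.sub ?_ (((S.meromorphicAt_resolvent₁ hw0 _ _).mul
    (MeromorphicAt.const _ w)).mul (h.analytic ν 1).meromorphicAt)
  split_ifs
  · exact (h.analytic σ 0).meromorphicAt
  · exact MeromorphicAt.const _ w

/-- At non-real points of the disk `λ` is non-real, where self-adjointness excludes degeneracy;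
these points accumulate at `w`, and the isolation of zeros does the rest. -/
theorem IsLocalJost.eventually_nondegenerate {w : ℂ} {e : C → ℕ → ℂ → ℂ} {d : C → ℂ → ℂ}
    (h : S.IsLocalJost w e d) (hw : ‖w‖ ≤ 1) (hw0 : w ≠ 0) (σ₀ : C) :
    ∀ᶠ ω in 𝓝[≠] w, S.det₁ (S.lam ω) ≠ 0 ∧ (S.TCont e ω).det ≠ 0 ∧ ∀ σ, e σ 1 ω ≠ 0 := by
  have := nhdsWithin_nonRealDisk_neBot hw
  have hs : w ∉ nonRealDisk w := fun h => h.2.2 rfl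
  have hle : 𝓝[nonRealDisk w] w ≤ 𝓝 w := nhdsWithin_le_nhds
  have him : ∀ᶠ ω in 𝓝[nonRealDisk w] w, (S.lam ω).im ≠ 0 ∧ ‖ω‖ < 1 := by
    filter_upwards [self_mem_nhdsWithin] with ω hω
    exact ⟨S.lam_im_ne_zero σ₀ hω.1 hω.2.1, hω.1⟩
  have hne : ∀ σ, ∀ᶠ ω in 𝓝[nonRealDisk w] w, ∃ k, e σ (k + 1) ω ≠ 0 := by
    intro σ
    obtain ⟨k, hk⟩ := h.exists_ne σ
    filter_upwards [((h.analytic σ (k + 1)).continuousAt.eventually_ne hk).filter_mono hle] with ω h1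
    exact ⟨k, h1⟩
  have hne' := eventually_all.2 hne
  have hsol := eventually_all.2 fun σ => (h.sol σ).filter_mono hle
  have htz := eventually_all.2 fun σ => (h.tendsto_zero σ).filter_mono hle
  refine Eventually.and ?_ (Eventually.and ?_ (eventually_all.2 fun σ => ?_))
  · refine (S.meromorphicAt_det₁ hw0).eventually_ne_zero_of_nhdsWithin hs ?_
    filter_upwards [him] with ω h1
    exact S.det₁_ne_zero h1.1
  · refine (MeromorphicAt.matrix_det (h.meromorphicAt_TCont hw0)).eventually_ne_zero_of_nhdsWithin
      hs ?_
    filter_upwards [him, hne', hsol, htz] with ω h1 h2 h3 h4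
    exact S.det_ne_zero_of_im_ne h1.1 (fun σ k => e σ k ω) h3 (fun σ => h4 σ h1.2) h2
  · refine (h.analytic σ 1).meromorphicAt.eventually_ne_zero_of_nhdsWithin hs ?_
    filter_upwards [him, hne', hsol, htz] with ω h1 h2 h3 h4
    exact ((h3 σ).one_ne_zero_of_im_ne (h4 σ h1.2) (h2 σ) h1.1).1

theorem IsLocalJost.eventually_U_eq {w : ℂ} {e : C → ℕ → ℂ → ℂ} {d : C → ℂ → ℂ}
    (h : S.IsLocalJost w e d) (hw : ‖w‖ ≤ 1) (hw0 : w ≠ 0) :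
    ∀ᶠ ω in 𝓝[Metric.ball 0 1 \ {w}] w, ∀ k σ ν, S.U k ω σ ν = S.UCont e d σ ν k ω := by
  rcases isEmpty_or_nonempty C with hC | ⟨⟨σ₀⟩⟩
  · exact Eventually.of_forall fun ω k σ => isEmptyElim σ
  have hle : 𝓝[Metric.ball 0 1 \ {w}] w ≤ 𝓝[≠] w := nhdsWithin_mono _ fun ω hω => hω.2
  have hle' : 𝓝[Metric.ball 0 1 \ {w}] w ≤ 𝓝 w := nhdsWithin_le_nhds
  filter_upwards [(h.eventually_nondegenerate hw hw0 σ₀).filter_mono hle, self_mem_nhdsWithin,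
    eventually_all.2 fun σ => (h.eq_jost σ).filter_mono hle',
    eventually_all.2 fun σ => (h.eq_d σ).filter_mono hle'] with ω h1 h2 h3 h4 k σ ν
  have hω : ‖ω‖ < 1 := by simpa using h2.1
  have hE : ∀ k, S.E k ω = Matrix.diagonal fun σ => e σ k ω := by
    intro k
    simp only [E, h3 _ hω]
  have hT : S.T ω = S.TCont e ω := by rw [T, TCont, hE, hE]
  have hD : S.D ω = Matrix.diagonal fun σ => d σ ω := by
    simp only [D, h4 _ hω]
  rw [U, hT, hD, hE, hE, diagonal_inv_of_ne_zero h1.2.2, B₀,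
    diagonal_inv_of_ne_zero fun σ => S.offCoeff_ne_zero σ 0, B, P]
  simp only [Matrix.mul_diagonal, Matrix.add_apply, Matrix.neg_apply, Matrix.diagonal_mul,
    Matrix.diagonal_apply, UCont]
  split_ifs with hσ
  · subst hσ; ring
  · ring

theorem IsLocalJost.isColumn {w : ℂ} {e : C → ℕ → ℂ → ℂ} {d : C → ℂ → ℂ}
    (h : S.IsLocalJost w e d) (hw : ‖w‖ ≤ 1) (hw0 : w ≠ 0) (ν : C) :
    ∃ x κ, S.IsColumn w e ν x (fun σ => S.UCont e d σ ν) κ := by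
  have hy : ∀ σ k, MeromorphicAt (S.UCont e d σ ν k) w := by
    intro σ k
    unfold UCont
    refine MeromorphicAt.mul (MeromorphicAt.add (MeromorphicAt.neg ?_) ?_) ?_
    · split_ifs
      · exact (S.analyticAt_pSol ν hw0 k).meromorphicAt
      · exact MeromorphicAt.const _ w
    · exact (h.analytic σ k).meromorphicAt.mul
        (MeromorphicAt.matrix_inv (h.meromorphicAt_TCont hw0) σ ν)
    · exact ((MeromorphicAt.const _ w).mul (h.analytic_d ν).meromorphicAt).mul
        (h.analytic ν 1).meromorphicAt.inv
  have hev := h.eventually_nondegenerate hw hw0 ν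
  -- The central values are forced by the channel values at `σ(1)`. In `κ` the factor `e_ν(1)⁻¹` of
  -- the column cancels, because `p_ν(0) = 1` and `p_ν(1) = 0` make the Wronskian of `p_ν` and `e_ν`
  -- equal to `𝔟_ν(0) e_ν(1)`.
  refine ⟨fun α ω => ∑ σ, S.resolvent₁ (S.lam ω) α (S.attach σ) *
    ((S.offCoeff σ 0 : ℂ) * S.UCont e d σ ν 1 ω), fun ω => - (S.bCh ν * d ν ω), fun α => ?_, hy,
    (analyticAt_const.mul (h.analytic_d ν)).neg, fun σ => ?_, fun σ => ?_, ?_, fun σ => ?_⟩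
  · exact MeromorphicAt.fun_sum fun σ _ => (S.meromorphicAt_resolvent₁ hw0 _ _).mul
      ((MeromorphicAt.const _ w).mul (hy σ 1))
  · filter_upwards [(h.sol σ).filter_mono nhdsWithin_le_nhds] with ω h1
    obtain ⟨c, hc⟩ : ∃ c, c = (S.bCh ν * (S.offCoeff ν 0 : ℂ)⁻¹ * d ν ω * (e ν 1 ω)⁻¹) := ⟨_, rfl⟩
    have h2 := (S.isChannelSol_pSol σ (S.lam ω)).smul_add h1 (-(if σ = ν then c else 0))
      ((S.TCont e ω)⁻¹ σ ν * c)
    convert h2 using 2 with k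
    simp only [UCont, ← hc]
    split_ifs with hσ
    · subst hσ; ring
    · ring
  · filter_upwards [hev] with ω h1
    obtain ⟨c, hc⟩ : ∃ c, c = (S.bCh ν * (S.offCoeff ν 0 : ℂ)⁻¹ * d ν ω * (e ν 1 ω)⁻¹) := ⟨_, rfl⟩
    -- The entry `(σ, ν)` of `T T⁻¹ = 1` is the matching condition at `σ(0)`: the identity entry
    -- cancels the term from `P(0) = 1`.
    have h2 : S.TCont e ω * (S.TCont e ω)⁻¹ = 1 :=
      Matrix.mul_nonsing_inv _ (isUnit_iff_ne_zero.2 h1.2.1)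
    have h3 := congrFun (congrFun h2 σ) ν
    conv_lhs at h3 => rw [TCont, sub_mul, Matrix.sub_apply, ← TCont]
    rw [Matrix.diagonal_mul, Matrix.mul_apply, Matrix.one_apply] at h3
    simp only [B₀, Matrix.mul_diagonal, R_apply] at h3
    have h4 : ∀ μ, S.UCont e d μ ν 1 ω = e μ 1 ω * (S.TCont e ω)⁻¹ μ ν * c := by
      intro μ
      simp only [UCont, pSol, ite_self, neg_zero, zero_add, ← hc]
    have h5 : S.UCont e d σ ν 0 ω =
        (-(if σ = ν then 1 else 0) + e σ 0 ω * (S.TCont e ω)⁻¹ σ ν) * c := by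
      simp only [UCont, pSol, ← hc]
    rw [h5, ← h3]
    simp only [h4]
    rw [neg_sub, sub_add_cancel, Finset.sum_mul]
    refine Finset.sum_congr rfl fun μ _ => ?_
    ring
  · filter_upwards [hev] with ω h1
    exact S.isCentralSol_resolvent₁ h1.1 _
  · filter_upwards [hev] with ω h1
    have hb := S.offCoeff_ne_zero ν 0
    have he := h1.2.2 ν
    simp only [UCont, pSol]
    split_ifs with hσ
    · subst hσ
      field_simp
      ring
    · ring

end WebSystem

/-! ### Removable singularities and radial approach -/

section Regular

/-- `f` agrees near `w`, except possibly at `w`, with a function that is analytic at `w`. -/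
def AnalyticOffAt (f : ℂ → ℂ) (w : ℂ) : Prop :=
  ∃ g : ℂ → ℂ, AnalyticAt ℂ g w ∧ f =ᶠ[𝓝[≠] w] g

theorem AnalyticAt.analyticOffAt {f : ℂ → ℂ} {w : ℂ} (h : AnalyticAt ℂ f w) :
    AnalyticOffAt f w := ⟨f, h, EventuallyEq.rfl⟩

theorem AnalyticOffAt.congr {f g : ℂ → ℂ} {w : ℂ} (h : AnalyticOffAt f w)
    (hfg : ∀ᶠ ω in 𝓝[≠] w, g ω = f ω) : AnalyticOffAt g w := by
  obtain ⟨F, hF, hf⟩ := h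
  exact ⟨F, hF, EventuallyEq.trans hfg hf⟩

theorem AnalyticOffAt.add {f g : ℂ → ℂ} {w : ℂ} (hf : AnalyticOffAt f w)
    (hg : AnalyticOffAt g w) : AnalyticOffAt (fun ω => f ω + g ω) w := by
  obtain ⟨F, hF, hf⟩ := hf
  obtain ⟨G, hG, hg⟩ := hg
  exact ⟨fun ω => F ω + G ω, hF.add hG, hf.add hg⟩

theorem AnalyticOffAt.mul {f g : ℂ → ℂ} {w : ℂ} (hf : AnalyticOffAt f w)
    (hg : AnalyticOffAt g w) : AnalyticOffAt (fun ω => f ω * g ω) w := by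
  obtain ⟨F, hF, hf⟩ := hf
  obtain ⟨G, hG, hg⟩ := hg
  exact ⟨fun ω => F ω * G ω, hF.mul hG, hf.mul hg⟩

/-- A meromorphic function of order `≤ 0` cannot tend to `0` along any approach. So `(ω - w) f` has
positive order and `f` has order at least `0`; a limit along one radius suffices. -/
theorem MeromorphicAt.analyticOffAt_of_tendsto {f : ℂ → ℂ} {w : ℂ} (hf : MeromorphicAt f w)
    {l : Filter ℂ} [NeBot l] (hl : l ≤ 𝓝[≠] w)
    (h : Tendsto (fun ω => (ω - w) * f ω) l (𝓝 0)) : AnalyticOffAt f w := by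
  refine hf.meromorphicOrderAt_nonneg_iff.1 ?_
  have hid : MeromorphicAt (fun ω : ℂ => ω - w) w :=
    (analyticAt_id.sub analyticAt_const).meromorphicAt
  have hm : MeromorphicAt (fun ω => (ω - w) * f ω) w := hid.mul hf
  have hpos : 0 < meromorphicOrderAt (fun ω => (ω - w) * f ω) w := by
    rcases lt_trichotomy (meromorphicOrderAt (fun ω => (ω - w) * f ω) w) 0 with h1 | h1 | h1
    · have h2 := (tendsto_norm_atTop_iff_cobounded.2
        (tendsto_cobounded_of_meromorphicOrderAt_neg h1)).mono_left hl
      exact absurd h2 (not_tendsto_atTop_of_tendsto_nhds h.norm)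
    · obtain ⟨c, hc, h2⟩ := tendsto_ne_zero_of_meromorphicOrderAt_eq_zero hm h1
      exact absurd (tendsto_nhds_unique (h2.mono_left hl) h) hc
    · exact h1
  have h1 : meromorphicOrderAt (fun ω : ℂ => ω - w) w = 1 := by simp
  have hmul : meromorphicOrderAt (fun ω => (ω - w) * f ω) w =
      meromorphicOrderAt (fun ω : ℂ => ω - w) w + meromorphicOrderAt f w :=
    meromorphicOrderAt_mul hid hf
  rw [hmul, h1] at hpos
  cases h2 : meromorphicOrderAt f w with
  | top => exact le_top
  | coe n =>
    rw [h2] at hpos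
    have h3 : (0 : ℤ) < 1 + n := by exact_mod_cast hpos
    have h4 : (0 : ℤ) ≤ n := by omega
    exact_mod_cast h4

/-- The filter of radial approach to `w` from inside the disk. -/
noncomputable def radial (w : ℂ) : Filter ℂ := map (fun t : ℝ => (t : ℂ) * w) (𝓝[<] 1)

theorem radial_neBot (w : ℂ) : NeBot (radial w) := by
  unfold radial; infer_instance

theorem radial_le {w : ℂ} (hw0 : w ≠ 0) : radial w ≤ 𝓝[≠] w := by
  refine tendsto_nhdsWithin_of_tendsto_nhds_of_eventually_within _ ?_ ?_
  · have : ContinuousAt (fun t : ℝ => (t : ℂ) * w) 1 := by fun_prop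
    have h := this.tendsto
    simp only [Complex.ofReal_one, one_mul] at h
    exact h.mono_left nhdsWithin_le_nhds
  · filter_upwards [self_mem_nhdsWithin] with t ht h
    have h1 : ((t : ℂ) - 1) * w = 0 := by
      have : (t : ℂ) * w = w := h
      linear_combination this
    have h2 := (mul_eq_zero.1 h1).resolve_right hw0
    have h3 : t = 1 := by exact_mod_cast sub_eq_zero.1 h2
    exact (ne_of_lt (Set.mem_Iio.1 ht)) h3

end Regular

/-! ### Energy estimate: no pole on channels with non-summable Jost solution -/

namespace WebSystem

variable {A C : Type*} {S : WebSystem A C}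

theorem lam_im_radial (σ : C) {w : ℂ} (hw : ‖w‖ = 1) (hi : w.im ≠ 0) :
    ∃ c : ℝ, 0 < c ∧ ∀ᶠ ω in radial w, ‖ω‖ < 1 ∧ ω.im ≠ 0 ∧ c * ‖ω - w‖ ≤ |(S.lam ω).im| := by
  have hb := S.b_pos σ
  refine ⟨S.b * |w.im|, by positivity, ?_⟩
  unfold radial
  rw [eventually_map]
  filter_upwards [self_mem_nhdsWithin,
    (lt_mem_nhds (zero_lt_one : (0 : ℝ) < 1)).filter_mono nhdsWithin_le_nhds] with t ht1 ht0
  have ht1 : t < 1 := ht1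
  have e1 : ‖(t : ℂ) * w‖ = t := by
    rw [norm_mul, hw, mul_one, Complex.norm_real, Real.norm_of_nonneg ht0.le]
  have e2 : ((t : ℂ) * w).im = t * w.im := by simp
  have e3 : ‖(t : ℂ) * w - w‖ = 1 - t := by
    have : (t : ℂ) * w - w = ((t - 1 : ℝ) : ℂ) * w := by push_cast; ring
    rw [this, norm_mul, hw, mul_one, Complex.norm_real, Real.norm_eq_abs, abs_sub_comm,
      abs_of_pos (by linarith)]
  refine ⟨by rw [e1]; exact ht1, by rw [e2]; exact mul_ne_zero ht0.ne' hi, ?_⟩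
  rw [lam_im, e2, e3, Complex.normSq_eq_norm_sq, e1]
  have e4 : S.b * (t * w.im) * ((t ^ 2)⁻¹ - 1) = (S.b * w.im) * ((1 - t) * ((1 + t) / t)) := by
    field_simp
    ring
  rw [e4, abs_mul, abs_mul, abs_of_pos hb, abs_of_nonneg (a := (1 - t) * _)
    (mul_nonneg (by linarith) (by positivity))]
  refine mul_le_mul_of_nonneg_left ?_ (by positivity)
  refine le_mul_of_one_le_right (by linarith) ?_
  rw [one_le_div ht0]
  linarith

variable [Fintype C]

theorem conj_mul_im_decompose (s a b p q : ℂ) :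
    ((starRingEnd ℂ) (s * a + p) * (s * b + q)).im =
      ‖s‖ ^ 2 * ((starRingEnd ℂ) a * b).im +
      ((starRingEnd ℂ) (s * a) * q + (starRingEnd ℂ) p * (s * b) + (starRingEnd ℂ) p * q).im := by
  have e : (starRingEnd ℂ) (s * a + p) * (s * b + q) =
      ((‖s‖ ^ 2 : ℝ) : ℂ) * ((starRingEnd ℂ) a * b) +
      ((starRingEnd ℂ) (s * a) * q + (starRingEnd ℂ) p * (s * b) + (starRingEnd ℂ) p * q) := by
    rw [← Complex.normSq_eq_norm_sq, ← Complex.mul_conj]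
    simp only [map_add, map_mul]
    ring
  rw [e, Complex.add_im, Complex.im_ofReal_mul]

theorem norm_cross_le (s a b p q : ℂ) :
    ‖(starRingEnd ℂ) (s * a) * q + (starRingEnd ℂ) p * (s * b) + (starRingEnd ℂ) p * q‖ ≤
      (‖a‖ * ‖q‖ + ‖p‖ * ‖b‖ + ‖p‖ * ‖q‖) * (‖s‖ + 1) := by
  refine (norm_add₃_le).trans ?_
  simp only [norm_mul, RCLike.norm_conj]
  nlinarith [mul_nonneg (norm_nonneg a) (norm_nonneg q), mul_nonneg (norm_nonneg p) (norm_nonneg b),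
    mul_nonneg (mul_nonneg (norm_nonneg p) (norm_nonneg q)) (norm_nonneg s)]

theorem mul_le_of_quadratic {t c K s : ℝ} (ht1 : t ≤ 1) (hc : 0 < c) (hK : 0 ≤ K)
    (hs : 0 ≤ s) (h : t * (s ^ 2 * c) ≤ K * (s + 1)) : t * s ≤ 2 * K / c + 1 := by
  by_cases hs1 : s ≤ 1
  · have : t * s ≤ 1 := mul_le_one₀ ht1 hs hs1
    have : 0 ≤ 2 * K / c := by positivity
    linarith
  · push Not at hs1
    have h1 : (t * s * c) * s ≤ (2 * K) * s := by nlinarith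
    have h2 := le_of_mul_le_mul_right h1 (by linarith)
    have h3 : t * s ≤ 2 * K / c := by rwa [le_div_iff₀ hc]
    linarith

/-- The parts `s σ * ε σ` contribute flux `Im z * ‖s σ‖² * G σ`, of one sign with the central term.
Only the channel `ν` has cross terms, and these are at most linear in `‖s ν‖`. -/
theorem energy_bound {z : ℂ} (hz : z.im ≠ 0) {x : S.central → ℂ} {v s q₀ q₁ : C → ℂ}
    {ε : C → ℕ → ℂ} {G : C → ℝ} {ν : C} (hx : S.IsCentralSol z x v)
    (h0 : ∀ σ, x (S.attach σ) = s σ * ε σ 0 + q₀ σ) (h1 : ∀ σ, v σ = s σ * ε σ 1 + q₁ σ)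
    (hq : ∀ σ, σ ≠ ν → q₀ σ = 0 ∧ q₁ σ = 0) (hG0 : ∀ σ, 0 ≤ G σ)
    (hG : ∀ σ, S.flux σ (ε σ) 0 = z.im * G σ) (σ : C) :
    |z.im| * (‖s σ‖ ^ 2 * G σ) ≤ S.offCoeff ν 0 *
      ((‖ε ν 0‖ * ‖q₁ ν‖ + ‖q₀ ν‖ * ‖ε ν 1‖ + ‖q₀ ν‖ * ‖q₁ ν‖) * (‖s ν‖ + 1)) := by
  have he := hx.energy
  obtain ⟨r, hr⟩ : ∃ r : C → ℂ, r = fun σ => (starRingEnd ℂ) (s σ * ε σ 0) * q₁ σ +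
    (starRingEnd ℂ) (q₀ σ) * (s σ * ε σ 1) + (starRingEnd ℂ) (q₀ σ) * q₁ σ := ⟨_, rfl⟩
  have hterm : ∀ σ, S.offCoeff σ 0 * ((starRingEnd ℂ) (x (S.attach σ)) * v σ).im =
      z.im * (‖s σ‖ ^ 2 * G σ) + S.offCoeff σ 0 * (r σ).im := by
    intro σ
    rw [h0, h1, conj_mul_im_decompose, hr]
    have := hG σ
    simp only [flux, zero_add] at this
    linear_combination ‖s σ‖ ^ 2 * this
  have hr0 : ∀ σ, σ ≠ ν → r σ = 0 := by
    intro σ hσ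
    simp [hr, hq σ hσ]
  simp only [hterm, Finset.sum_add_distrib] at he
  have hsum : ∑ σ, S.offCoeff σ 0 * (r σ).im = S.offCoeff ν 0 * (r ν).im :=
    Finset.sum_eq_single_of_mem ν (Finset.mem_univ ν) fun σ _ hσ => by
      rw [hr0 σ hσ, Complex.zero_im, mul_zero]
  rw [← Finset.mul_sum, hsum, ← add_assoc, ← mul_add] at he
  have hX : 0 ≤ ∑ α, ‖x α‖ ^ 2 := by positivity
  have hs : ‖s σ‖ ^ 2 * G σ ≤ ∑ σ, ‖s σ‖ ^ 2 * G σ :=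
    Finset.single_le_sum (f := fun σ => ‖s σ‖ ^ 2 * G σ)
      (fun σ _ => mul_nonneg (by positivity) (hG0 σ)) (Finset.mem_univ σ)
  have hS : 0 ≤ ∑ σ, ‖s σ‖ ^ 2 * G σ :=
    Finset.sum_nonneg fun σ _ => mul_nonneg (by positivity) (hG0 σ)
  calc |z.im| * (‖s σ‖ ^ 2 * G σ)
      ≤ |z.im| * (∑ α, ‖x α‖ ^ 2 + ∑ σ, ‖s σ‖ ^ 2 * G σ) := by gcongr; linarith
    _ = |z.im * (∑ α, ‖x α‖ ^ 2 + ∑ σ, ‖s σ‖ ^ 2 * G σ)| := by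
        rw [abs_mul, abs_of_nonneg (add_nonneg hX hS)]
    _ = |S.offCoeff ν 0 * (r ν).im| := by
        rw [eq_neg_of_add_eq_zero_left he, abs_neg]
    _ ≤ S.offCoeff ν 0 * ‖r ν‖ := by
        rw [abs_mul, abs_of_pos (S.offCoeff_pos ν 0)]
        exact mul_le_mul_of_nonneg_left (Complex.abs_im_le_norm _) (S.offCoeff_pos ν 0).le
    _ ≤ _ := by
        rw [hr]
        exact mul_le_mul_of_nonneg_left (norm_cross_le _ _ _ _ _) (S.offCoeff_pos ν 0).le

variable [DecidableEq C]

/-- One of `e σ 0 w`, `e σ 1 w` is non-zero. Dividing by it defines `s` and makes the remainder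
vanish at that index; at the other index it is the Wronskian over a non-vanishing analytic function,
up to sign. -/
theorem IsColumn.decompose {w : ℂ} {e : C → ℕ → ℂ → ℂ} {d : C → ℂ → ℂ} {ν : C}
    {x : S.central → ℂ → ℂ} {y : C → ℕ → ℂ → ℂ} {κ : ℂ → ℂ} (hc : S.IsColumn w e ν x y κ)
    (h : S.IsLocalJost w e d) (σ : C) :
    ∃ s q₀ q₁ : ℂ → ℂ, MeromorphicAt s w ∧ AnalyticAt ℂ q₀ w ∧ AnalyticAt ℂ q₁ w ∧
      (∀ᶠ ω in 𝓝[≠] w, y σ 0 ω = s ω * e σ 0 ω + q₀ ω ∧ y σ 1 ω = s ω * e σ 1 ω + q₁ ω) ∧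
      (σ ≠ ν → q₀ = 0 ∧ q₁ = 0) := by
  have hb := S.offCoeff_ne_zero σ 0
  have hκ : AnalyticAt ℂ (fun ω => if σ = ν then κ ω else 0) w := by
    split_ifs
    · exact hc.analytic
    · exact analyticAt_const
  rcases (h.sol σ).self_of_nhds.zero_or_one_ne (h.exists_ne σ) with h0 | h1
  · refine ⟨fun ω => y σ 0 ω / e σ 0 ω, 0,
      fun ω => -((if σ = ν then κ ω else 0) / ((S.offCoeff σ 0 : ℂ) * e σ 0 ω)),
      (hc.mero_y σ 0).div (h.analytic σ 0).meromorphicAt, analyticAt_const,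
      (hκ.div (analyticAt_const.mul (h.analytic σ 0)) (mul_ne_zero hb h0)).neg, ?_, ?_⟩
    · filter_upwards [hc.wronskian σ,
        ((h.analytic σ 0).continuousAt.eventually_ne h0).filter_mono nhdsWithin_le_nhds] with ω h2 h3
      rw [← h2]
      constructor
      · simp only [Pi.zero_apply]
        field_simp
        ring
      · field_simp
        ring
    · intro hσ
      simp only [if_neg hσ, zero_div, neg_zero, true_and]
      rfl
  · refine ⟨fun ω => y σ 1 ω / e σ 1 ω,
      fun ω => (if σ = ν then κ ω else 0) / ((S.offCoeff σ 0 : ℂ) * e σ 1 ω), 0,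
      (hc.mero_y σ 1).div (h.analytic σ 1).meromorphicAt,
      hκ.div (analyticAt_const.mul (h.analytic σ 1)) (mul_ne_zero hb h1), analyticAt_const, ?_, ?_⟩
    · filter_upwards [hc.wronskian σ,
        ((h.analytic σ 1).continuousAt.eventually_ne h1).filter_mono nhdsWithin_le_nhds] with ω h2 h3
      rw [← h2]
      constructor
      · field_simp
        ring
      · simp only [Pi.zero_apply]
        field_simp
        ring
    · intro hσ
      simp only [if_neg hσ, zero_div, and_true]
      rfl

theorem IsColumn.analyticOffAt_of_zero_one {w : ℂ} {e : C → ℕ → ℂ → ℂ} {ν : C}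
    {x : S.central → ℂ → ℂ} {y : C → ℕ → ℂ → ℂ} {κ : ℂ → ℂ} (hc : S.IsColumn w e ν x y κ)
    (hw0 : w ≠ 0) {σ : C} (h0 : AnalyticOffAt (y σ 0) w) (h1 : AnalyticOffAt (y σ 1) w) (k : ℕ) :
    AnalyticOffAt (y σ k) w := by
  have : ∀ k, AnalyticOffAt (y σ k) w ∧ AnalyticOffAt (y σ (k + 1)) w := by
    intro k
    induction k with
    | zero => exact ⟨h0, h1⟩
    | succ k ih =>
      refine ⟨ih.2, ?_⟩
      have ha : AnalyticAt ℂ (fun ω => ((S.diagCoeff σ (k + 1) : ℂ) - S.lam ω) /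
          (S.offCoeff σ (k + 1) : ℂ)) w :=
        (analyticAt_const.sub (S.analyticAt_lam hw0)).div analyticAt_const
          (S.offCoeff_ne_zero σ _)
      have hb : AnalyticAt ℂ (fun _ : ℂ => -(S.offCoeff σ k : ℂ) / (S.offCoeff σ (k + 1) : ℂ)) w :=
        analyticAt_const
      refine ((ha.analyticOffAt.mul ih.2).add (hb.analyticOffAt.mul ih.1)).congr ?_
      filter_upwards [hc.sol σ] with ω h
      rw [h.next k]
      ring
  exact (this k).1

theorem IsColumn.analyticOffAt_of_not_summable {w : ℂ} {e : C → ℕ → ℂ → ℂ} {d : C → ℂ → ℂ} {ν : C}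
    {x : S.central → ℂ → ℂ} {y : C → ℕ → ℂ → ℂ} {κ : ℂ → ℂ} (hc : S.IsColumn w e ν x y κ)
    (h : S.IsLocalJost w e d) (hw : ‖w‖ = 1) (hi : w.im ≠ 0) {σ₀ : C}
    (hns : ¬ Summable fun k => ‖e σ₀ (k + 1) w‖ ^ 2) (k : ℕ) : AnalyticOffAt (y σ₀ k) w := by
  have hw0 : w ≠ 0 := fun h => hi (by simp [h])
  choose s q₀ q₁ hs hq₀ hq₁ hdec hzero using hc.decompose h
  have := radial_neBot w
  have hle := radial_le hw0
  have hle' : radial w ≤ 𝓝 w := hle.trans nhdsWithin_le_nhds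
  obtain ⟨c, hc0, hrad⟩ := lam_im_radial (S := S) ν hw hi
  obtain ⟨kν, hkν⟩ := h.exists_ne ν
  -- uniform bounds near `w`
  obtain ⟨g, hg0, hg⟩ : ∃ g : ℝ, 0 < g ∧ ∀ᶠ ω in 𝓝 w, g ≤ ‖e ν (kν + 1) ω‖ ^ 2 := by
    have hpos : 0 < ‖e ν (kν + 1) w‖ ^ 2 := by positivity
    refine ⟨‖e ν (kν + 1) w‖ ^ 2 / 2, by positivity, ?_⟩
    exact (((h.analytic ν (kν + 1)).continuousAt.norm.pow 2).eventually_const_lt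
      (half_lt_self hpos)).mono fun ω h => h.le
  obtain ⟨K, hK0, hK⟩ : ∃ K : ℝ, 0 < K ∧ ∀ᶠ ω in 𝓝 w, S.offCoeff ν 0 *
      (‖e ν 0 ω‖ * ‖q₁ ν ω‖ + ‖q₀ ν ω‖ * ‖e ν 1 ω‖ + ‖q₀ ν ω‖ * ‖q₁ ν ω‖) ≤ K := by
    have hb := S.offCoeff_pos ν 0
    have hcont : ContinuousAt (fun ω => S.offCoeff ν 0 *
        (‖e ν 0 ω‖ * ‖q₁ ν ω‖ + ‖q₀ ν ω‖ * ‖e ν 1 ω‖ + ‖q₀ ν ω‖ * ‖q₁ ν ω‖)) w := by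
      have c1 := (h.analytic ν 0).continuousAt.norm
      have c2 := (h.analytic ν 1).continuousAt.norm
      have c3 := (hq₀ ν).continuousAt.norm
      have c4 := (hq₁ ν).continuousAt.norm
      exact continuousAt_const.mul (((c1.mul c4).add (c3.mul c2)).add (c3.mul c4))
    refine ⟨S.offCoeff ν 0 * (‖e ν 0 w‖ * ‖q₁ ν w‖ + ‖q₀ ν w‖ * ‖e ν 1 w‖ +
      ‖q₀ ν w‖ * ‖q₁ ν w‖) + 1, by positivity, ?_⟩
    exact (hcont.eventually_lt_const (lt_add_one _)).mono fun ω h => h.le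
  have hle1 : ∀ᶠ ω in 𝓝 w, |(S.lam ω).im| ≤ 1 := by
    have hcont : ContinuousAt (fun ω => |(S.lam ω).im|) w :=
      (Complex.continuous_im.continuousAt.comp (S.analyticAt_lam hw0).continuousAt).abs
    refine (hcont.eventually_lt_const ?_).mono fun ω h => h.le
    simp only [lam_im, Complex.normSq_eq_norm_sq, hw]
    norm_num
  have hattach := eventually_all.2 fun σ => (hc.attach σ).filter_mono hle
  have hdec' := eventually_all.2 fun σ => (hdec σ).filter_mono hle
  have hsol := eventually_all.2 fun σ => (h.sol σ).filter_mono hle'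
  have htz := eventually_all.2 fun σ => (h.tendsto_zero σ).filter_mono hle'
  -- the main estimate
  have hmain : ∀ᶠ ω in radial w, ∃ G : C → ℝ, (∀ σ N, ∑ k ∈ Finset.range N, ‖e σ (k + 1) ω‖ ^ 2 ≤
      G σ) ∧ |(S.lam ω).im| ^ 2 * (‖s σ₀ ω‖ ^ 2 * G σ₀) ≤ K * (2 * K / g + 2) := by
    filter_upwards [hrad, hg.filter_mono hle', hK.filter_mono hle', hle1.filter_mono hle',
      hattach, hdec', hsol, htz, hc.central.filter_mono hle] with ω h1 h2 h3 h4 h5 h6 h7 h8 h9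
    have hz := S.lam_im_ne_zero ν h1.1 h1.2.1
    choose G hG hGN using fun σ => (h7 σ).flux_zero_eq (h8 σ h1.1) hz
    have hG0 : ∀ σ, 0 ≤ G σ := fun σ => by simpa using hGN σ 0
    refine ⟨G, hGN, ?_⟩
    have hbound : ∀ σ, |(S.lam ω).im| * (‖s σ ω‖ ^ 2 * G σ) ≤ K * (‖s ν ω‖ + 1) := by
      intro σ
      refine (energy_bound hz (s := fun σ => s σ ω) (q₀ := fun σ => q₀ σ ω)
        (q₁ := fun σ => q₁ σ ω) (ε := fun σ k => e σ k ω) (ν := ν) h9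
        (fun σ => (h5 σ).symm.trans (h6 σ).1) (fun σ => (h6 σ).2) (fun σ hσ => ?_) hG0 hG σ).trans ?_
      · simp [hzero σ hσ]
      · rw [← mul_assoc]
        exact mul_le_mul_of_nonneg_right h3 (by positivity)
    -- A single non-zero term of the sum bounds `G ν` from below uniformly near `w`.
    have hgG : g ≤ G ν := by
      refine h2.trans (le_trans ?_ (hGN ν (kν + 1)))
      exact Finset.single_le_sum (f := fun k => ‖e ν (k + 1) ω‖ ^ 2)
        (fun k _ => by positivity) (Finset.mem_range.2 kν.lt_succ_self)
    -- For `σ = ν` the bound is quadratic on the left and linear on the right, so it limits `s ν`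
    -- itself.
    have hsν : |(S.lam ω).im| * ‖s ν ω‖ ≤ 2 * K / g + 1 := by
      refine mul_le_of_quadratic h4 hg0 hK0.le (norm_nonneg _) ?_
      refine le_trans ?_ (hbound ν)
      gcongr
    calc |(S.lam ω).im| ^ 2 * (‖s σ₀ ω‖ ^ 2 * G σ₀)
        = |(S.lam ω).im| * (|(S.lam ω).im| * (‖s σ₀ ω‖ ^ 2 * G σ₀)) := by ring
      _ ≤ |(S.lam ω).im| * (K * (‖s ν ω‖ + 1)) := by exact mul_le_mul_of_nonneg_left (hbound σ₀) (abs_nonneg _)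
      _ = K * (|(S.lam ω).im| * ‖s ν ω‖ + |(S.lam ω).im|) := by ring
      _ ≤ K * (2 * K / g + 2) := mul_le_mul_of_nonneg_left (by linarith) hK0.le
  have hlim : Tendsto (fun ω => (ω - w) * s σ₀ ω) (radial w) (𝓝 0) := by
    rw [tendsto_zero_iff_norm_tendsto_zero]
    refine Metric.tendsto_nhds.2 fun η hη => ?_
    -- Chosen so that `(c η)² M` exceeds the bound in `hmain`. Some partial sum at `w` exceeds `M`
    -- by divergence; being finite, it does so near `w` as well, hence `G σ₀ ≥ M` there.
    obtain ⟨M, hM⟩ : ∃ M : ℝ, M = K * (2 * K / g + 2) / (c * η) ^ 2 + 1 := ⟨_, rfl⟩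
    have hMpos : 0 < M := by rw [hM]; positivity
    obtain ⟨N, hN⟩ := (((not_summable_iff_tendsto_nat_atTop_of_nonneg
      fun k => by positivity).1 hns).eventually_gt_atTop M).exists
    have hcont : ContinuousAt (fun ω => ∑ k ∈ Finset.range N, ‖e σ₀ (k + 1) ω‖ ^ 2) w :=
      tendsto_finsetSum _ fun k _ => (h.analytic σ₀ (k + 1)).continuousAt.norm.pow 2
    filter_upwards [hmain, (hcont.eventually_const_lt hN).filter_mono hle', hrad]
      with ω ⟨G, hGN, hG⟩ h2 h3
    have hMG : M ≤ G σ₀ := h2.le.trans (hGN σ₀ N)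
    rw [dist_zero_right, norm_norm, norm_mul]
    by_contra! hcon
    have h4 : c * η ≤ |(S.lam ω).im| * ‖s σ₀ ω‖ := by
      calc c * η ≤ c * (‖ω - w‖ * ‖s σ₀ ω‖) := by gcongr
        _ = (c * ‖ω - w‖) * ‖s σ₀ ω‖ := by ring
        _ ≤ _ := by gcongr; exact h3.2.2
    have h5 : (c * η) ^ 2 * M ≤ K * (2 * K / g + 2) := by
      calc (c * η) ^ 2 * M ≤ (|(S.lam ω).im| * ‖s σ₀ ω‖) ^ 2 * G σ₀ := by gcongr
        _ = |(S.lam ω).im| ^ 2 * (‖s σ₀ ω‖ ^ 2 * G σ₀) := by ring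
        _ ≤ _ := hG
    have h6 : 0 < (c * η) ^ 2 := by positivity
    rw [hM, mul_add, mul_div_cancel₀ _ h6.ne'] at h5
    linarith
  have hreg : AnalyticOffAt (s σ₀) w := (hs σ₀).analyticOffAt_of_tendsto hle hlim
  refine hc.analyticOffAt_of_zero_one hw0 ?_ ?_ k
  · exact ((hreg.mul (h.analytic σ₀ 0).analyticOffAt).add (hq₀ σ₀).analyticOffAt).congr
      ((hdec σ₀).mono fun ω h => h.1)
  · exact ((hreg.mul (h.analytic σ₀ 1).analyticOffAt).add (hq₁ σ₀).analyticOffAt).congr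
      ((hdec σ₀).mono fun ω h => h.2)

end WebSystem

/-! ### Leading Laurent coefficients of a column -/

namespace WebSystem

variable {A C : Type*} {S : WebSystem A C} [Fintype C] [DecidableEq C]

theorem IsColumn.analyticOffAt_of_order {w : ℂ} {e : C → ℕ → ℂ → ℂ} {ν : C}
    {x : S.central → ℂ → ℂ} {y : C → ℕ → ℂ → ℂ} {κ : ℂ → ℂ} (hc : S.IsColumn w e ν x y κ)
    (hw0 : w ≠ 0) (hx : ∀ α, 0 ≤ meromorphicOrderAt (x α) w)
    (hy : ∀ σ, 0 ≤ meromorphicOrderAt (y σ 1) w) (σ : C) (k : ℕ) : AnalyticOffAt (y σ k) w := by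
  refine hc.analyticOffAt_of_zero_one hw0 ?_ ((hc.mero_y σ 1).meromorphicOrderAt_nonneg_iff.1 (hy σ)) k
  exact AnalyticOffAt.congr
    ((hc.mero_x (S.attach σ)).meromorphicOrderAt_nonneg_iff.1 (hx (S.attach σ))) (hc.attach σ)

/-- A finite family of meromorphic functions, one of which has a pole at `w`, can be multiplied by
a positive power of `ω - w` so that all have limits at `w`, which are not all zero. -/
theorem exists_pow_mul_tendsto {ι : Type*} [Finite ι] {f : ι → ℂ → ℂ} {w : ℂ}
    (hf : ∀ i, MeromorphicAt (f i) w) (hpole : ∃ i, meromorphicOrderAt (f i) w < 0) :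
    ∃ (m : ℕ) (c : ι → ℂ), 0 < m ∧ (∃ i, c i ≠ 0) ∧
      ∀ i, Tendsto (fun ω => (ω - w) ^ m * f i ω) (𝓝[≠] w) (𝓝 (c i)) := by
  obtain ⟨i₁, hi₁⟩ := hpole
  have : Nonempty ι := ⟨i₁⟩
  obtain ⟨i₀, hi₀⟩ := Finite.exists_min fun i => meromorphicOrderAt (f i) w
  have hneg : meromorphicOrderAt (f i₀) w < 0 := (hi₀ i₁).trans_lt hi₁
  obtain ⟨n, hn⟩ := WithTop.ne_top_iff_exists.1 (ne_top_of_lt hneg)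
  rw [← hn] at hneg hi₀
  have hn0 : n < 0 := by exact_mod_cast hneg
  obtain ⟨m, hm⟩ := Int.eq_ofNat_of_zero_le (by omega : 0 ≤ -n)
  have hpow : MeromorphicAt (fun ω : ℂ => (ω - w) ^ m) w :=
    ((analyticAt_id.sub analyticAt_const).pow m).meromorphicAt
  have hmul : ∀ i, meromorphicOrderAt (fun ω => (ω - w) ^ m * f i ω) w =
      ((m : ℤ) : WithTop ℤ) + meromorphicOrderAt (f i) w := by
    intro i
    have h1 : meromorphicOrderAt (fun ω : ℂ => (ω - w) ^ m) w = ((m : ℤ) : WithTop ℤ) :=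
      meromorphicOrderAt_pow_id_sub_const
    rw [← h1]
    exact meromorphicOrderAt_mul hpow (hf i)
  have hmero : ∀ i, MeromorphicAt (fun ω => (ω - w) ^ m * f i ω) w := fun i => hpow.mul (hf i)
  have hz : ((m : ℤ) : WithTop ℤ) + (n : WithTop ℤ) = 0 := by
    rw [← WithTop.coe_add]
    have : (m : ℤ) + n = 0 := by omega
    rw [this]
    rfl
  have hlim : ∀ i, ∃ c, Tendsto (fun ω => (ω - w) ^ m * f i ω) (𝓝[≠] w) (𝓝 c) := by
    intro i
    refine tendsto_nhds_of_meromorphicOrderAt_nonneg (hmero i) ?_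
    rw [hmul, ← hz]
    exact add_le_add_right (hi₀ i) _
  choose c hc using hlim
  refine ⟨m, c, by omega, ⟨i₀, ?_⟩, hc⟩
  obtain ⟨c', hc', h2⟩ := tendsto_ne_zero_of_meromorphicOrderAt_eq_zero (hmero i₀)
    (by rw [hmul, ← hn, hz])
  rwa [tendsto_nhds_unique (hc i₀) h2]

/-- Multiply by `(ω - w) ^ m`, where `m` is the largest pole order among the central values and the
values at `σ(1)`. The linear equations pass to the limit, while anything regular, in particular `κ`,
is sent to `0`. -/
theorem IsColumn.exists_limit {w : ℂ} {e : C → ℕ → ℂ → ℂ} {d : C → ℂ → ℂ} {ν : C}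
    {x : S.central → ℂ → ℂ} {y : C → ℕ → ℂ → ℂ} {κ : ℂ → ℂ} (hc : S.IsColumn w e ν x y κ)
    (h : S.IsLocalJost w e d) (hw0 : w ≠ 0) (hpole : ∃ σ k, ¬ AnalyticOffAt (y σ k) w) :
    ∃ (X : S.central → ℂ) (Y : C → ℕ → ℂ), S.IsCentralSol (S.lam w) X (fun σ => Y σ 1) ∧
      (∀ σ, Y σ 0 = X (S.attach σ)) ∧ (∀ σ, S.IsChannelSol σ (S.lam w) (Y σ)) ∧
      (∀ σ, ∃ c, ∀ k, Y σ k = c * e σ k w) ∧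
      (∀ σ, (∀ k, AnalyticOffAt (y σ k) w) → ∀ k, Y σ k = 0) ∧
      ((∃ α, X α ≠ 0) ∨ ∃ σ, Y σ 1 ≠ 0) := by
  have hfm : ∀ i : S.central ⊕ C, MeromorphicAt (Sum.elim x (fun σ => y σ 1) i) w := by
    rintro (α | σ)
    · exact hc.mero_x α
    · exact hc.mero_y σ 1
  -- The recurrence generates each channel from indices `0` and `1`, so a pole anywhere shows up in
  -- this finite family.
  have hneg : ∃ i : S.central ⊕ C, meromorphicOrderAt (Sum.elim x (fun σ => y σ 1) i) w < 0 := by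
    by_contra! hcon
    obtain ⟨σ, k, hk⟩ := hpole
    exact hk (hc.analyticOffAt_of_order hw0 (fun α => hcon (Sum.inl α))
      (fun σ => hcon (Sum.inr σ)) σ k)
  obtain ⟨m, c, hm, ⟨i, hi⟩, hlim⟩ := exists_pow_mul_tendsto hfm hneg
  have hX : ∀ α, Tendsto (fun ω => (ω - w) ^ m * x α ω) (𝓝[≠] w) (𝓝 (c (Sum.inl α))) :=
    fun α => hlim (Sum.inl α)
  have hlamt : Tendsto S.lam (𝓝[≠] w) (𝓝 (S.lam w)) :=
    (S.analyticAt_lam hw0).continuousAt.tendsto.mono_left nhdsWithin_le_nhds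
  have hpow0 : Tendsto (fun ω : ℂ => (ω - w) ^ m) (𝓝[≠] w) (𝓝 0) := by
    have : ContinuousAt (fun ω : ℂ => (ω - w) ^ m) w := by fun_prop
    have h1 := this.tendsto
    simp only [sub_self, zero_pow hm.ne'] at h1
    exact h1.mono_left nhdsWithin_le_nhds
  have hY : ∀ σ k, ∃ t, Tendsto (fun ω => (ω - w) ^ m * y σ k ω) (𝓝[≠] w) (𝓝 t) := by
    intro σ k
    have : ∀ k, (∃ t, Tendsto (fun ω => (ω - w) ^ m * y σ k ω) (𝓝[≠] w) (𝓝 t)) ∧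
        ∃ t, Tendsto (fun ω => (ω - w) ^ m * y σ (k + 1) ω) (𝓝[≠] w) (𝓝 t) := by
      intro k
      induction k with
      | zero =>
        refine ⟨⟨_, (hX (S.attach σ)).congr' ?_⟩, _, hlim (Sum.inr σ)⟩
        filter_upwards [hc.attach σ] with ω h1
        rw [h1]
      | succ k ih =>
        obtain ⟨⟨t0, h0⟩, t1, h1⟩ := ih
        refine ⟨⟨t1, h1⟩, _, ((((hlamt.const_sub (S.diagCoeff σ (k + 1) : ℂ)).mul h1).sub
          (h0.const_mul (S.offCoeff σ k : ℂ))).div_const (S.offCoeff σ (k + 1) : ℂ)).congr' ?_⟩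
        filter_upwards [hc.sol σ] with ω h2
        rw [h2.next k]
        ring
    exact (this k).1
  choose Y hY using hY
  refine ⟨fun α => c (Sum.inl α), Y, ?_, ?_, ?_, ?_, ?_, ?_⟩
  · classical
    intro α
    have t1 : Tendsto (fun ω => S.L₁.mulVec (fun β => (ω - w) ^ m * x β ω) α) (𝓝[≠] w)
        (𝓝 (S.L₁.mulVec (fun β => c (Sum.inl β)) α)) :=
      tendsto_finsetSum _ fun β _ => (hX β).const_mul _
    have t2 : Tendsto (fun ω => S.lam ω * ((ω - w) ^ m * x α ω) +
        ∑ σ, if S.attach σ = α then (S.offCoeff σ 0 : ℂ) * ((ω - w) ^ m * y σ 1 ω) else 0)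
        (𝓝[≠] w) (𝓝 (S.lam w * c (Sum.inl α) +
          ∑ σ, if S.attach σ = α then (S.offCoeff σ 0 : ℂ) * Y σ 1 else 0)) := by
      refine (hlamt.mul (hX α)).add (tendsto_finsetSum _ fun σ _ => ?_)
      split_ifs
      · exact (hY σ 1).const_mul _
      · exact tendsto_const_nhds
    have e := tendsto_nhds_unique (t1.congr' ?_) t2
    · convert e
    · filter_upwards [hc.central] with ω h1
      have h2 := h1 α
      have h3 : S.L₁.mulVec (fun β => (ω - w) ^ m * x β ω) α =
          (ω - w) ^ m * S.L₁.mulVec (fun β => x β ω) α := by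
        simp only [Matrix.mulVec, dotProduct, Finset.mul_sum]
        exact Finset.sum_congr rfl fun _ _ => by ring
      rw [h3, h2, mul_add, Finset.mul_sum]
      congr 1
      · ring
      · refine Finset.sum_congr rfl fun σ _ => ?_
        split_ifs <;> ring
  · intro σ
    refine tendsto_nhds_unique (hY σ 0) ((hX (S.attach σ)).congr' ?_)
    filter_upwards [hc.attach σ] with ω h1
    rw [h1]
  · intro σ k
    have t1 := (((hY σ k).const_mul (-(S.offCoeff σ k : ℂ))).add
      ((hY σ (k + 1)).const_mul (S.diagCoeff σ (k + 1) : ℂ))).sub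
      ((hY σ (k + 2)).const_mul (S.offCoeff σ (k + 1) : ℂ))
    refine tendsto_nhds_unique (t1.congr' ?_) (hlamt.mul (hY σ (k + 1)))
    filter_upwards [hc.sol σ] with ω h1
    linear_combination (ω - w) ^ m * h1 k
  · intro σ
    have hsol : S.IsChannelSol σ (S.lam w) (Y σ) := by
      intro k
      have t1 := (((hY σ k).const_mul (-(S.offCoeff σ k : ℂ))).add
        ((hY σ (k + 1)).const_mul (S.diagCoeff σ (k + 1) : ℂ))).sub
        ((hY σ (k + 2)).const_mul (S.offCoeff σ (k + 1) : ℂ))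
      refine tendsto_nhds_unique (t1.congr' ?_) (hlamt.mul (hY σ (k + 1)))
      filter_upwards [hc.sol σ] with ω h1
      linear_combination (ω - w) ^ m * h1 k
    have het : ∀ k, Tendsto (e σ k) (𝓝[≠] w) (𝓝 (e σ k w)) := fun k =>
      (h.analytic σ k).continuousAt.tendsto.mono_left nhdsWithin_le_nhds
    have hW : (S.offCoeff σ 0 : ℂ) * (Y σ 0 * e σ 1 w - Y σ 1 * e σ 0 w) = 0 := by
      have t1 := (((hY σ 0).mul (het 1)).sub ((hY σ 1).mul (het 0))).const_mul (S.offCoeff σ 0 : ℂ)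
      have hκ : Tendsto (fun ω => if σ = ν then κ ω else 0) (𝓝[≠] w)
          (𝓝 (if σ = ν then κ w else 0)) := by
        split_ifs
        · exact hc.analytic.continuousAt.tendsto.mono_left nhdsWithin_le_nhds
        · exact tendsto_const_nhds
      have t2 := hpow0.mul hκ
      rw [zero_mul] at t2
      refine tendsto_nhds_unique (t1.congr' ?_) t2
      filter_upwards [hc.wronskian σ] with ω h1
      linear_combination (ω - w) ^ m * h1
    have hW' := (mul_eq_zero.1 hW).resolve_left (S.offCoeff_ne_zero σ 0)
    have hes := (h.sol σ).self_of_nhds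
    have key : ∀ t, Y σ 0 = t * e σ 0 w → Y σ 1 = t * e σ 1 w → ∀ k, Y σ k = t * e σ k w := by
      intro t h0 h1 k
      have := (hsol.smul_add hes 1 (-t)).eq_zero_of_forward (by rw [h0]; ring) (by rw [h1]; ring) k
      linear_combination this
    rcases hes.zero_or_one_ne (h.exists_ne σ) with h0 | h1
    · refine ⟨Y σ 0 / e σ 0 w, key _ (by field_simp) ?_⟩
      field_simp
      linear_combination - hW'
    · refine ⟨Y σ 1 / e σ 1 w, key _ ?_ (by field_simp)⟩
      field_simp
      linear_combination hW'
  · intro σ hreg k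
    obtain ⟨g, hg, hgy⟩ := hreg k
    have t := hpow0.mul (hg.continuousAt.tendsto.mono_left (nhdsWithin_le_nhds (s := {w}ᶜ)))
    rw [zero_mul] at t
    refine tendsto_nhds_unique (hY σ k) (t.congr' ?_)
    filter_upwards [hgy] with ω h1
    rw [h1]
  · rcases i with α | σ
    · exact Or.inl ⟨α, hi⟩
    · refine Or.inr ⟨σ, ?_⟩
      rwa [tendsto_nhds_unique (hY σ 1) (hlim (Sum.inr σ))]

end WebSystem

/-! ### Gluing central and channel values to an eigenvector -/

namespace WebSystem

variable {A C : Type*} (S : WebSystem A C)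

theorem chan_not_mem_central (σ : C) (k : ℕ) : S.chan σ (k + 1) ∉ S.central :=
  fun h => h σ k rfl

theorem partition_bijective : Function.Bijective
    (Sum.elim (fun α : S.central => (α : A)) fun p : C × ℕ => S.chan p.1 (p.2 + 1)) := by
  constructor
  · rintro (α | ⟨σ, k⟩) (β | ⟨ν, j⟩) h
    · exact congrArg _ (Subtype.ext h)
    · exact absurd α.2 (by rw [show (α : A) = S.chan ν (j + 1) from h]; exact S.chan_not_mem_central ν j)
    · exact absurd β.2 (by rw [← show S.chan σ (k + 1) = (β : A) from h]; exact S.chan_not_mem_central σ k)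
    · obtain ⟨h1, h2⟩ := S.chan_inj _ _ _ _ h
      have h3 : k = j := by simpa using h2
      have h1 : σ = ν := h1
      rw [h1, h3]
  · intro α
    by_cases h : α ∈ S.central
    · exact ⟨Sum.inl ⟨α, h⟩, rfl⟩
    · simp only [central, Set.mem_ofPred_eq, not_forall, not_not] at h
      obtain ⟨σ, k, h⟩ := h
      exact ⟨Sum.inr (σ, k), h.symm⟩

/-- Every particle is either in the central part or one of the `σ(k)` with `k ≥ 1`. -/
noncomputable def partition : S.central ⊕ C × ℕ ≃ A :=
  Equiv.ofBijective _ S.partition_bijective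

theorem L_chan_eq_zero {σ : C} {k : ℕ} {β : A} (h0 : β ≠ S.chan σ k) (h1 : β ≠ S.chan σ (k + 1))
    (h2 : β ≠ S.chan σ (k + 2)) : S.L (S.chan σ (k + 1)) β = 0 := by
  by_contra h
  rcases S.chan_only σ k β h with h | h | h
  exacts [h0 h, h1 h, h2 h]

theorem chan_ne_of_ne {σ : C} {j k : ℕ} (h : j ≠ k) : S.chan σ j ≠ S.chan σ k :=
  fun h' => h (S.chan_inj _ _ _ _ h').2

/-- The function on the particles with values `X` on the central part and `Y` on the channels. -/
noncomputable def glue (X : S.central → ℂ) (Y : C → ℕ → ℂ) (α : A) : ℂ :=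
  Sum.elim X (fun p : C × ℕ => Y p.1 (p.2 + 1)) (S.partition.symm α)

theorem glue_central (X : S.central → ℂ) (Y : C → ℕ → ℂ) (α : S.central) :
    S.glue X Y α = X α := by
  have : S.partition.symm (α : A) = Sum.inl α := by
    rw [Equiv.symm_apply_eq]; rfl
  rw [glue, this, Sum.elim_inl]

theorem glue_chan_succ (X : S.central → ℂ) (Y : C → ℕ → ℂ) (σ : C) (k : ℕ) :
    S.glue X Y (S.chan σ (k + 1)) = Y σ (k + 1) := by
  have : S.partition.symm (S.chan σ (k + 1)) = Sum.inr (σ, k) := by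
    rw [Equiv.symm_apply_eq]; rfl
  rw [glue, this, Sum.elim_inr]

theorem glue_chan {X : S.central → ℂ} {Y : C → ℕ → ℂ} (h : ∀ σ, Y σ 0 = X (S.attach σ))
    (σ : C) (k : ℕ) : S.glue X Y (S.chan σ k) = Y σ k := by
  rcases k with _ | k
  · rw [h]
    exact S.glue_central X Y (S.attach σ)
  · exact S.glue_chan_succ X Y σ k

/-- On the unit circle, the points `±1` are mapped to thresholds. -/
theorem im_ne_zero_of_not_threshold (σ : C) {w : ℂ} (hw : ‖w‖ = 1)
    (hthr : ∀ γ, S.lam w ≠ ((S.aCh γ - 2 * S.bCh γ : ℝ) : ℂ) ∧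
      S.lam w ≠ ((S.aCh γ + 2 * S.bCh γ : ℝ) : ℂ)) : w.im ≠ 0 := by
  intro hi
  have hb := S.b_pos σ
  have hre : w = (w.re : ℂ) := Complex.ext rfl (by simpa using hi)
  have habs : |w.re| = 1 := by rw [← hw, hre, Complex.norm_real]; simp
  have hmem : ∀ t ∈ Set.Icc (S.a - 2 * S.b) (S.a + 2 * S.b), ∃ γ,
      t ∈ Set.Icc (S.aCh γ - 2 * S.bCh γ) (S.aCh γ + 2 * S.bCh γ) := by
    intro t ht
    rw [← S.union_eq] at ht
    exact Set.mem_iUnion.1 ht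
  -- `λ(±1) = a ∓ 2b` are the ends of the union of the channel segments, and such an end is an end
  -- of one of the segments.
  rcases eq_or_eq_neg_of_abs_eq habs with h1 | h1
  · obtain ⟨γ, hγ⟩ := hmem (S.a - 2 * S.b) ⟨le_rfl, by linarith⟩
    have h2 : S.a - 2 * S.b = S.aCh γ - 2 * S.bCh γ :=
      le_antisymm (S.channel_interval_le γ).1 hγ.1
    refine (hthr γ).1 ?_
    rw [← h2, hre, h1, lam]
    push_cast
    norm_num
    ring
  · obtain ⟨γ, hγ⟩ := hmem (S.a + 2 * S.b) ⟨by linarith, le_rfl⟩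
    have h2 : S.a + 2 * S.b = S.aCh γ + 2 * S.bCh γ :=
      le_antisymm hγ.2 (S.channel_interval_le γ).2
    refine (hthr γ).2 ?_
    rw [← h2, hre, h1, lam]
    push_cast
    norm_num
    ring

variable [Fintype C]

theorem glue_memℓp {X : S.central → ℂ} {Y : C → ℕ → ℂ}
    (h : ∀ σ, Summable fun k => ‖Y σ (k + 1)‖ ^ 2) : Memℓp (S.glue X Y) 2 := by
  refine memℓp_gen ?_
  have e : (fun α => ‖S.glue X Y α‖ ^ (2 : ENNReal).toReal) ∘ S.partition =
      Sum.elim (fun α => ‖X α‖ ^ 2) (fun p : C × ℕ => ‖Y p.1 (p.2 + 1)‖ ^ 2) := by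
    funext i
    rcases i with α | p <;> simp [glue]
  rw [← S.partition.summable_iff, e]
  have hp : Summable fun p : C × ℕ => ‖Y p.1 (p.2 + 1)‖ ^ 2 := by
    rw [summable_prod_of_nonneg fun _ => by positivity]
    exact ⟨h, (hasSum_fintype _).summable⟩
  exact (HasSum.sum (f := Sum.elim (fun α => ‖X α‖ ^ 2) (fun p : C × ℕ => ‖Y p.1 (p.2 + 1)‖ ^ 2))
    (hasSum_fintype _) hp.hasSum).summable

theorem glue_eigen {X : S.central → ℂ} {Y : C → ℕ → ℂ} {z : ℂ}
    (hX : S.IsCentralSol z X fun σ => Y σ 1) (h0 : ∀ σ, Y σ 0 = X (S.attach σ))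
    (hY : ∀ σ, S.IsChannelSol σ z (Y σ)) (α : A) :
    ∑ᶠ β, (S.L α β : ℂ) * S.glue X Y β = z * S.glue X Y α := by
  classical
  obtain ⟨i, rfl⟩ := S.partition.surjective α
  rcases i with α | ⟨σ, k⟩
  · have e : S.partition (Sum.inl α) = (α : A) := rfl
    rw [e]
    -- A central particle meets a channel only through the link `σ(0)`–`σ(1)`, with coefficient
    -- `-𝔟_σ(0)`; this cancels the source term of `IsCentralSol`.
    have hfin : ∀ p : C × ℕ, S.L α (S.chan p.1 (p.2 + 1)) =
        if p.2 = 0 ∧ S.attach p.1 = α then - S.offCoeff p.1 0 else 0 := by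
      rintro ⟨σ, k⟩
      have hα := α.2
      split_ifs with hp
      · obtain ⟨hp1, hp2⟩ := hp
        have hk : k = 0 := hp1
        subst hk
        have : S.attach σ = α := hp2
        rw [← this, offCoeff, neg_neg]
        rfl
      · rw [S.symm]
        refine S.L_chan_eq_zero (fun h => ?_) (hα σ k) (hα σ (k + 1))
        rcases k with _ | k
        · exact hp ⟨rfl, Subtype.ext h.symm⟩
        · exact hα σ k h
    rw [← finsum_comp_equiv S.partition]
    have hsub : Function.support (fun i => (S.L α (S.partition i) : ℂ) * S.glue X Y (S.partition i)) ⊆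
        (Finset.univ.disjSum (Finset.univ.image fun σ : C => (σ, 0)) :
          Finset (S.central ⊕ C × ℕ)) := by
      rintro (β | ⟨σ, k⟩) hi
      · simp
      · have hne : S.L α (S.chan σ (k + 1)) ≠ 0 := by
          intro h
          refine hi ?_
          have : S.partition (Sum.inr (σ, k)) = S.chan σ (k + 1) := rfl
          simp only [this, h, Complex.ofReal_zero, zero_mul]
        rw [hfin (σ, k)] at hne
        have : k = 0 := by
          by_contra hk
          simp [hk] at hne
        subst this
        simp
    rw [finsum_eq_sum_of_support_subset _ hsub, Finset.sum_disjSum,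
      Finset.sum_image fun a _ b _ h => (Prod.mk.inj h).1]
    have e1 : ∀ β : S.central, S.partition (Sum.inl β) = (β : A) := fun _ => rfl
    have e2 : ∀ σ : C, S.partition (Sum.inr (σ, 0)) = S.chan σ (0 + 1) := fun _ => rfl
    have hc := hX α
    simp only [Matrix.mulVec, dotProduct, L₁, Matrix.of_apply] at hc
    simp only [e1, e2, glue_central, glue_chan_succ]
    rw [hc, add_assoc, ← Finset.sum_add_distrib, Finset.sum_eq_zero, add_zero]
    intro σ _
    have := hfin (σ, 0)
    simp only [true_and] at this
    rw [this]
    split_ifs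
    · push_cast
      ring
    · simp
  · have e : S.partition (Sum.inr (σ, k)) = S.chan σ (k + 1) := rfl
    rw [e]
    have n1 : S.chan σ k ≠ S.chan σ (k + 1) := S.chan_ne_of_ne (by omega)
    have n2 : S.chan σ k ≠ S.chan σ (k + 2) := S.chan_ne_of_ne (by omega)
    have n3 : S.chan σ (k + 1) ≠ S.chan σ (k + 2) := S.chan_ne_of_ne (by omega)
    have hsub : Function.support (fun β => (S.L (S.chan σ (k + 1)) β : ℂ) * S.glue X Y β) ⊆
        ({S.chan σ k, S.chan σ (k + 1), S.chan σ (k + 2)} : Finset A) := by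
      intro β hβ
      simp only [Finset.coe_insert, Finset.coe_singleton, Set.mem_insert_iff,
        Set.mem_singleton_iff]
      by_contra! hcon
      refine hβ ?_
      simp only [S.L_chan_eq_zero hcon.1 hcon.2.1 hcon.2.2, Complex.ofReal_zero, zero_mul]
    rw [finsum_eq_sum_of_support_subset _ hsub, Finset.sum_insert (by simp [n1, n2]),
      Finset.sum_insert (by simp [n3]), Finset.sum_singleton]
    simp only [S.glue_chan h0]
    have := hY σ k
    simp only [offCoeff, diagCoeff, Complex.ofReal_neg, neg_neg] at this
    rw [← this, S.symm (S.chan σ (k + 1)) (S.chan σ k)]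
    ring

theorem isEigenvalue_of_glue {X : S.central → ℂ} {Y : C → ℕ → ℂ} {z : ℂ}
    (hX : S.IsCentralSol z X fun σ => Y σ 1) (h0 : ∀ σ, Y σ 0 = X (S.attach σ))
    (hY : ∀ σ, S.IsChannelSol σ z (Y σ)) (hs : ∀ σ, Summable fun k => ‖Y σ (k + 1)‖ ^ 2)
    (hne : (∃ α, X α ≠ 0) ∨ ∃ σ, Y σ 1 ≠ 0) : S.IsEigenvalue z := by
  refine ⟨⟨S.glue X Y, S.glue_memℓp hs⟩, fun h => ?_, S.glue_eigen hX h0 hY⟩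
  have hz : ∀ α, S.glue X Y α = 0 := fun α => congrFun (congrArg Subtype.val h) α
  rcases hne with ⟨α, hα⟩ | ⟨σ, hσ⟩
  · exact hα (by rw [← S.glue_central X Y α, hz])
  · exact hσ (by rw [← S.glue_chan_succ X Y σ 0, hz])

end WebSystem

/-! ### Poles of `U` and the main theorem -/

theorem not_analyticOffAt_of_hasPoleAt {f g : ℂ → ℂ} {w : ℂ} (hw : ‖w‖ ≤ 1)
    (hfg : ∀ᶠ ω in 𝓝[Metric.ball 0 1 \ {w}] w, f ω = g ω) (hf : HasPoleAt f w) :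
    ¬ AnalyticOffAt g w := by
  rintro ⟨G, hG, hgG⟩
  obtain ⟨F, hF, hF0, hFf⟩ := hf
  have : NeBot (𝓝[Metric.ball 0 1 \ {w}] w) := by
    have := nhdsWithin_nonRealDisk_neBot hw
    exact NeBot.mono this (nhdsWithin_mono _ fun ω hω => ⟨by simpa using hω.1, hω.2.2⟩)
  have hle : 𝓝[Metric.ball 0 1 \ {w}] w ≤ 𝓝[≠] w := nhdsWithin_mono _ fun ω hω => hω.2
  have h1 : Tendsto F (𝓝[Metric.ball 0 1 \ {w}] w) (𝓝 (G w)) := by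
    refine (hG.continuousAt.tendsto.mono_left nhdsWithin_le_nhds).congr' ?_
    filter_upwards [hfg, hFf, hgG.filter_mono hle] with ω h1 h2 h3
    rw [h2, h1, h3]
  exact not_tendsto_atTop_of_tendsto_nhds h1.norm
    ((tendsto_norm_atTop_iff_cobounded.2
      (tendsto_cobounded_of_meromorphicOrderAt_neg hF0)).mono_left hle)

theorem mainTheorem7 {A C : Type*} [Fintype C] [DecidableEq C] (S : WebSystem A C)
    (w : ℂ) (hw : ‖w‖ ≤ 1) (hw0 : w ≠ 0)
    (hthr : ∀ γ, S.lam w ≠ ((S.aCh γ - 2 * S.bCh γ : ℝ) : ℂ) ∧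
      S.lam w ≠ ((S.aCh γ + 2 * S.bCh γ : ℝ) : ℂ))
    (k : ℕ) (hpole : ∃ σ ν, HasPoleAt (fun ω => S.U k ω σ ν) w) :
    S.IsEigenvalue (S.lam w) ∧
      ∀ σ, w ∈ S.TPlus σ → ∀ ν j, IsRegularAt (fun ω => S.U j ω σ ν) w := by
  obtain ⟨e, d, h⟩ := S.exists_isLocalJost hw hw0 hthr
  have hU := h.eventually_U_eq hw hw0
  have hreg : ∀ σ, (¬ Summable fun k => ‖e σ (k + 1) w‖ ^ 2) → ∀ ν j,
      AnalyticOffAt (S.UCont e d σ ν j) w := by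
    intro σ hs ν j
    obtain ⟨x, κ, hc⟩ := h.isColumn hw hw0 ν
    have hw1 : ‖w‖ = 1 := ((h.dichotomy σ).resolve_left fun h' => hs h'.2).1
    exact hc.analyticOffAt_of_not_summable h hw1 (S.im_ne_zero_of_not_threshold σ hw1 hthr) hs j
  refine ⟨?_, fun σ hσ ν j => ?_⟩
  · obtain ⟨σ, ν, hp⟩ := hpole
    obtain ⟨x, κ, hc⟩ := h.isColumn hw hw0 ν
    have hna : ¬ AnalyticOffAt (S.UCont e d σ ν k) w :=
      not_analyticOffAt_of_hasPoleAt hw (hU.mono fun ω h1 => h1 k σ ν) hp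
    obtain ⟨X, Y, hX, h0, hY, hprop, hzero, hne⟩ := hc.exists_limit h hw0 ⟨σ, k, hna⟩
    refine S.isEigenvalue_of_glue hX h0 hY (fun γ => ?_) hne
    -- Either the Jost solution is square summable, and so is its multiple, or the column is regular
    -- on this channel and its leading coefficient there is `0`.
    by_cases hs : Summable fun k => ‖e γ (k + 1) w‖ ^ 2
    · obtain ⟨c, hc'⟩ := hprop γ
      refine (hs.mul_left (‖c‖ ^ 2)).congr fun k => ?_
      rw [hc', norm_mul, mul_pow]
    · have hz := hzero γ (hreg γ hs ν)
      simp [hz, summable_zero]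
  · obtain ⟨g, hg, hgU⟩ := hreg σ ((h.dichotomy σ).resolve_left fun h' => h'.1 hσ).2 ν j
    refine ⟨g, hg, ?_⟩
    filter_upwards [hU, hgU.filter_mono (nhdsWithin_mono w fun ω hω => hω.2)] with ω h1 h2
    rw [h1, h2]
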